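/- Let $n\ge 2$, let $\Omega\subset\mathbb R^n$ be open, bounded and connected (and nonempty), let $\delta>0$, $\Omega_\delta=\bigcup_{x\in\Omega}B(x,\delta)$, and $f\in L^2(\Omega)$, $\ell(v)=\int_\Omega f v\,dx$. Let $A_\delta:\mathbb R_+\to\mathbb R_+$ be a radial kernel such that $\frac1n\int_{\mathbb R^n}A_\delta(|x|)\,dx=1$, $A_\delta(|x|)=0$ for $x\notin B(0,\delta)$, and, for some $s\in(0,1)$ and $c_\delta>0$, $$A_\delta(|x|)\ge \frac{c_\delta}{|x|^{n+2s-2}}\qquad\text{for all } x\in B(0,\delta/2)\setminus\{0\}.$$ For a conductivity $\kappa$ on $\Omega_\delta\times\Omega_\delta$ put $$a_{\delta,\kappa}(u,v)=\int_{\Omega_\delta}\int_{\Omega_\delta}\kappa(x,x')A_\delta(|x-x'|)\frac{u(x)-u(x')}{|x-x'|}\,\frac{v(x)-v(x')}{|x-x'|}\,dx\,dx'.$$ Let $\mathcal U^\delta=\{u\in L^2(\Omega_\delta): a_{\delta,1}(u,u)<\infty\}$, let $\mathcal U_0^\delta$ be the closure of $C_c^\infty(\Omega)$ (functions extended by $0$)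 in $\mathcal U^\delta$ with respect to the norm $\big(\|u\|_{L^2(\Omega_\delta)}^2+a_{\delta,1}(u,u)\big)^{1/2}$, and let $\|u\|_{\mathcal U_0^\delta}=a_{\delta,1}(u,u)^{1/2}$ for $u\in\mathcal U_0^\delta$. Let $0<\underline\rho<\overline\rho<\infty$, $\gamma\in(\underline\rho,\overline\rho)$ and $$\mathcal A^\delta=\Big\{\rho\in L^\infty(\Omega_\delta):\ \underline\rho\le\rho\le\overline\rho\ \text{a.e. in }\Omega_\delta,\ \int_\Omega\rho\,dx\le\gamma|\Omega|\Big\}.$$ Let $p=2$ and let $J:\mathcal A^\delta\times\mathcal U^\delta\to\mathbb R$ be sequentially lower semicontinuous on $\mathcal A^\delta\times\mathcal U_0^\delta$ with respect to (weak$^*$ topology of $L^\infty(\Omega_\delta)$) $\times$ (norm topology of $\mathcal U_0^\delta$). Then the nonlocal optimal design problem $$\min_{(\rho,u)\in\mathcal A^\delta\times\mathcal U_0^\delta} J(\rho,u)\quad\text{subject to}\quad a_{\delta,\kappa}(u,v)=\ell(v)\ \ \forall v\in\mathcal U_0^\delta,\qquad \kappa(x,x')=\rho^{p/2}(x)\rho^{p/2}(x')=\rho(x)\rho(x'),$$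 has an optimal solution: there is a feasible pair $(\rho^*,u^*)\in\mathcal A^\delta\times\mathcal U_0^\delta$ with $J(\rho^*,u^*)\le J(\rho,u)$ for every feasible pair $(\rho,u)$. -/

import Mathlib

open MeasureTheory Filter Topology
open scoped ENNReal ContDiff

namespace NonlocalDesign

noncomputable section

/-- Euclidean space `ℝⁿ`. -/
abbrev E (n : ℕ) : Type := EuclideanSpace ℝ (Fin n)

/-- Lebesgue measure on `Ω_δ = ⋃ x ∈ Ω, B(x, δ)` (the open `δ`-thickening of `Ω`). -/
abbrev volD {n : ℕ} (Ω : Set (E n)) (δ : ℝ) : Measure (E n) :=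
  volume.restrict (Metric.thickening δ Ω)

/-- The space `L^∞(Ω_δ)`, where the material distributions live. -/
abbrev DesignSpace {n : ℕ} (Ω : Set (E n)) (δ : ℝ) : Type := Lp ℝ ∞ (volD Ω δ)

/-- The space `L²(Ω_δ)`, where the states live. -/
abbrev StateSpace {n : ℕ} (Ω : Set (E n)) (δ : ℝ) : Type := Lp ℝ 2 (volD Ω δ)

/-- The conditions on the radial kernel `A = A_δ : ℝ₊ → ℝ₊` at horizon `δ`: nonnegativity,
normalization, support in the ball of radius `δ`, and a fractional lower bound near the origin.
Only the values of `A` on `[0, ∞)` matter. -/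
structure IsKernel (n : ℕ) (δ : ℝ) (A : ℝ → ℝ) : Prop where
  nonneg : ∀ r : ℝ, 0 ≤ r → 0 ≤ A r
  integrable : Integrable (fun x : E n => A ‖x‖) volume
  normalized : (1 / (n : ℝ)) * ∫ x : E n, A ‖x‖ = 1
  support_subset : Function.support (fun x : E n => A ‖x‖) ⊆ Metric.ball 0 δ
  lower_bound : ∃ s : ℝ, 0 < s ∧ s < 1 ∧ ∃ c : ℝ, 0 < c ∧
    ∀ x : E n, x ∈ Metric.ball (0 : E n) (δ / 2) → x ≠ 0 →
      c / ‖x‖ ^ ((n : ℝ) + 2 * s - 2) ≤ A ‖x‖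

/-- The integrand of the nonlocal form `a_{δ,κ}(u,v)`. -/
def formIntegrand {n : ℕ} (A : ℝ → ℝ) (κ : E n → E n → ℝ) (u v : E n → ℝ) (z : E n × E n) : ℝ :=
  κ z.1 z.2 * A ‖z.1 - z.2‖ * ((u z.1 - u z.2) / ‖z.1 - z.2‖) *
    ((v z.1 - v z.2) / ‖z.1 - z.2‖)

/-- The nonlocal bilinear form `a_{δ,κ}(u,v)`, an integral over `Ω_δ × Ω_δ`. -/
def form {n : ℕ} (Ω : Set (E n)) (δ : ℝ) (A : ℝ → ℝ) (κ : E n → E n → ℝ) (u v : E n → ℝ) : ℝ :=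
  ∫ z, formIntegrand A κ u v z ∂((volD Ω δ).prod (volD Ω δ))

/-- The constant conductivity `1`. -/
def unitCond {n : ℕ} : E n → E n → ℝ := fun _ _ => 1

/-- The energy space `U^δ = {u ∈ L²(Ω_δ) | a_{δ,1}(u,u) < ∞}`. The integrand of `a_{δ,1}(u,u)` is
nonnegative, so finiteness of the integral is integrability. -/
def energySpace {n : ℕ} (Ω : Set (E n)) (δ : ℝ) (A : ℝ → ℝ) : Set (StateSpace Ω δ) :=
  {u | Integrable (formIntegrand A unitCond u u) ((volD Ω δ).prod (volD Ω δ))}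

/-- Test functions: `C_c^∞(Ω)`, extended by zero to `ℝⁿ`. -/
def IsTestFunction {n : ℕ} (Ω : Set (E n)) (φ : E n → ℝ) : Prop :=
  ContDiff ℝ ∞ φ ∧ HasCompactSupport φ ∧ tsupport φ ⊆ Ω

/-- The space `U_0^δ`: the closure of `C_c^∞(Ω)` in `U^δ` for the Hilbert norm
`(‖u‖²_{L²(Ω_δ)} + a_{δ,1}(u,u))^{1/2}` of `U^δ`. -/
def energySpaceZero {n : ℕ} (Ω : Set (E n)) (δ : ℝ) (A : ℝ → ℝ) : Set (StateSpace Ω δ) :=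
  {u | u ∈ energySpace Ω δ A ∧ ∀ ε : ℝ, 0 < ε → ∃ φ : E n → ℝ, IsTestFunction Ω φ ∧
    (∫ x, (u x - φ x) ^ 2 ∂(volD Ω δ)) +
      form Ω δ A unitCond (fun x => u x - φ x) (fun x => u x - φ x) < ε}

/-- The norm `‖u‖_{U_0^δ} = a_{δ,1}(u,u)^{1/2}`. -/
def stateNorm {n : ℕ} (Ω : Set (E n)) (δ : ℝ) (A : ℝ → ℝ) (u : StateSpace Ω δ) : ℝ :=
  √(form Ω δ A unitCond u u)

/-- The load functional `ℓ(v) = ∫_Ω f v`. -/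
def load {n : ℕ} (Ω : Set (E n)) (f v : E n → ℝ) : ℝ := ∫ x in Ω, f x * v x

/-- The set `A^δ` of admissible material distributions. -/
def admissible {n : ℕ} (Ω : Set (E n)) (δ ρlo ρhi γ : ℝ) : Set (DesignSpace Ω δ) :=
  {ρ | (∀ᵐ x ∂(volD Ω δ), ρlo ≤ ρ x ∧ ρ x ≤ ρhi) ∧ ∫ x in Ω, ρ x ≤ γ * volume.real Ω}

/-- The nonlocal conductivity `κ(x,x') = ρ^{p/2}(x) ρ^{p/2}(x')` with SIMP exponent `p`. -/
def simpCond {n : ℕ} (p : ℝ) (ρ : E n → ℝ) : E n → E n → ℝ :=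
  fun x x' => ρ x ^ (p / 2) * ρ x' ^ (p / 2)

/-- `u ∈ U_0^δ` solves the nonlocal state equation `a_{δ,κ}(u,v) = ℓ(v)` for all `v ∈ U_0^δ`. -/
def IsState {n : ℕ} (Ω : Set (E n)) (δ : ℝ) (A : ℝ → ℝ) (f : E n → ℝ) (κ : E n → E n → ℝ)
    (u : StateSpace Ω δ) : Prop :=
  u ∈ energySpaceZero Ω δ A ∧
    ∀ v ∈ energySpaceZero Ω δ A, form Ω δ A κ u v = load Ω f v

/-- Feasible pairs of the optimal design problem with exponent `p`: admissible `ρ` together with a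
state `u ∈ U_0^δ` for the conductivity `ρ^{p/2}(x) ρ^{p/2}(x')`. -/
def feasible {n : ℕ} (Ω : Set (E n)) (δ : ℝ) (A : ℝ → ℝ) (f : E n → ℝ) (ρlo ρhi γ p : ℝ) :
    Set (DesignSpace Ω δ × StateSpace Ω δ) :=
  {q | q.1 ∈ admissible Ω δ ρlo ρhi γ ∧ IsState Ω δ A f (simpCond p q.1) q.2}

/-- Weak* convergence of a sequence in `L^∞(Ω_δ) = L¹(Ω_δ)*`. -/
def WeakStarTendsto {n : ℕ} {Ω : Set (E n)} {δ : ℝ} (ρ : ℕ → DesignSpace Ω δ)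
    (ρ' : DesignSpace Ω δ) : Prop :=
  ∀ ψ : E n → ℝ, Integrable ψ (volD Ω δ) →
    Tendsto (fun k => ∫ x, ρ k x * ψ x ∂(volD Ω δ)) atTop (𝓝 (∫ x, ρ' x * ψ x ∂(volD Ω δ)))

/-- Sequential lower semicontinuity of `J` on `A^δ × U_0^δ` with respect to
(weak* topology of `L^∞(Ω_δ)`) × (norm topology of `U_0^δ`). Only the values of `J` on
`A^δ × U_0^δ` matter. -/
def SeqLowerSemicontinuousObjective {n : ℕ} (Ω : Set (E n)) (δ : ℝ) (A : ℝ → ℝ) (ρlo ρhi γ : ℝ)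
    (J : DesignSpace Ω δ → StateSpace Ω δ → ℝ) : Prop :=
  ∀ (ρ : ℕ → DesignSpace Ω δ) (ρ' : DesignSpace Ω δ)
    (u : ℕ → StateSpace Ω δ) (u' : StateSpace Ω δ),
    (∀ k, ρ k ∈ admissible Ω δ ρlo ρhi γ) → ρ' ∈ admissible Ω δ ρlo ρhi γ →
    (∀ k, u k ∈ energySpaceZero Ω δ A) → u' ∈ energySpaceZero Ω δ A →
    WeakStarTendsto ρ ρ' →
    Tendsto (fun k => stateNorm Ω δ A (u k - u')) atTop (𝓝 0) →
    (J ρ' u' : EReal) ≤ liminf (fun k => (J (ρ k) (u k) : EReal)) atTop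

end

end NonlocalDesign

open NonlocalDesign

/-!
The design-to-state map turns weak* convergence of the designs into convergence of the states in
energy norm, so the direct method applies: a minimizing sequence has a subsequence converging in
exactly the topology in which `J` is lower semicontinuous, and the limit is feasible.

* **Hilbert space.** With `diffQuot A u (x, x') = √A(|x - x'|) (u x - u x') / |x - x'|`, the form
  `a_{δ,κ}(u, v)` is the `L²` pairing of `κ • diffQuot A u` and `diffQuot A v`. The space `U_0^δ` is
  realized as `stateGraph`, the closure of the graph of `diffQuot A` over the test functions in
  `L²(Ω_δ) × L²(Ω_δ × Ω_δ)`.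
* **Poincaré inequality** (`IsKernel.exists_lintegral_poincare`). A function vanishing off `Ω` is
  compared with its translate by `m • h`, where `δ / 4 < |h| < δ / 2` and `m • h` moves `Ω` off
  itself; the `m` single steps are controlled by the energy. It gives coercivity, hence solvability
  of the state equation, and a uniform bound on the states.
* **Compactness** (`IsKernel.tendsto_norm_of_weak`). By the fractional lower bound on the kernel a
  function differs from its averages over balls of radius `ε` by `O(ε ^ s)` times the square root of
  its energy, and the averages of a weakly null sequence tend to zero by dominated convergence.
* **Conductivities** (`tendsto_integral_mul_conductivity`). If `ρ_k → ρ` weakly*, then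
  `ρ_k(x) ρ_k(x') → ρ(x) ρ(x')` weakly* on the product: after integrating an integrable kernel
  against `ρ_k` in one variable the result converges strongly in `L¹` in the other.
* **Strong convergence of states** (`IsKernel.exists_subseq_tendsto_state`). Let `u_k`, `u` be the
  states of `ρ_k`, `ρ`, let `w_k = u_k - u`, and let `w` be a weak limit of `w_k`. Then
  `ρlo ^ 2 a(w_k, w_k) ≤ ℓ(w_k) - a_k(u, w) - a_k(u, w_k - w)`. The first two terms tend to `ℓ(w)`
  and `a_ρ(u, w) = ℓ(w)`. The last one tends to zero whatever the oscillations of `ρ_k`, because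
  `w_k - w → 0` in `L²` with bounded energy
  (`IsKernel.tendsto_integral_abs_mul_abs_diffQuot`).
-/

namespace NonlocalDesign

open scoped RealInnerProductSpace

/-! ### Weak compactness and the Cauchy-Schwarz inequality -/

/-- Every bounded sequence in a separable Hilbert space has a weakly convergent subsequence. -/
theorem exists_weakly_convergent_subseq {V : Type*} [NormedAddCommGroup V] [InnerProductSpace ℝ V]
    [CompleteSpace V] [TopologicalSpace.SeparableSpace V] {x : ℕ → V} {C : ℝ}
    (hx : ∀ k, ‖x k‖ ≤ C) :
    ∃ (y : V) (φ : ℕ → ℕ), StrictMono φ ∧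
      ∀ v : V, Tendsto (fun k => ⟪x (φ k), v⟫) atTop (𝓝 ⟪y, v⟫) := by
  have hmem : ∀ k, StrongDual.toWeakDual (InnerProductSpace.toDual ℝ V (x k)) ∈
      (WeakDual.toStrongDual ⁻¹' Metric.closedBall (0 : StrongDual ℝ V) C) := by
    intro k
    simpa using hx k
  obtain ⟨a, -, φ, hφ, ha⟩ := WeakDual.isSeqCompact_closedBall ℝ V 0 C hmem
  refine ⟨(InnerProductSpace.toDual ℝ V).symm (WeakDual.toStrongDual a), φ, hφ, fun v => ?_⟩
  have h := ((WeakDual.eval_continuous v).tendsto a).comp ha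
  rw [InnerProductSpace.toDual_symm_apply]
  exact h

section CauchySchwarz

variable {α : Type*} [MeasurableSpace α] {μ : Measure α}

theorem integral_mul_eq_inner {f g : α → ℝ} (hf : MemLp f 2 μ) (hg : MemLp g 2 μ) :
    ∫ x, f x * g x ∂μ = ⟪hf.toLp f, hg.toLp g⟫ := by
  rw [L2.inner_def]
  refine integral_congr_ae ?_
  filter_upwards [hf.coeFn_toLp, hg.coeFn_toLp] with x h1 h2
  simp [h1, h2, mul_comm]

theorem inner_eq_integral (f g : Lp ℝ 2 μ) : ⟪f, g⟫ = ∫ x, f x * g x ∂μ := by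
  rw [L2.inner_def]
  simp [mul_comm]

theorem norm_sq_eq_integral (f : Lp ℝ 2 μ) : ‖f‖ ^ 2 = ∫ x, f x ^ 2 ∂μ := by
  rw [← real_inner_self_eq_norm_sq, inner_eq_integral]
  simp only [sq]

theorem norm_toLp_sq {f : α → ℝ} (hf : MemLp f 2 μ) : ‖hf.toLp f‖ ^ 2 = ∫ x, f x ^ 2 ∂μ := by
  rw [← real_inner_self_eq_norm_sq, ← integral_mul_eq_inner hf hf]
  simp only [sq]

theorem abs_integral_mul_le {f g : α → ℝ} (hf : MemLp f 2 μ) (hg : MemLp g 2 μ) :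
    |∫ x, f x * g x ∂μ| ≤ √(∫ x, f x ^ 2 ∂μ) * √(∫ x, g x ^ 2 ∂μ) := by
  rw [integral_mul_eq_inner hf hg, ← norm_toLp_sq hf, ← norm_toLp_sq hg,
    Real.sqrt_sq (norm_nonneg _), Real.sqrt_sq (norm_nonneg _)]
  exact abs_real_inner_le_norm _ _

theorem sq_integral_le [IsFiniteMeasure μ] {f : α → ℝ} (hf : MemLp f 2 μ) :
    (∫ x, f x ∂μ) ^ 2 ≤ μ.real Set.univ * ∫ x, f x ^ 2 ∂μ := by
  have h := abs_integral_mul_le (memLp_const (1 : ℝ)) hf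
  simp only [one_mul, one_pow, integral_const, smul_eq_mul, mul_one] at h
  rw [← sq_abs]
  have h0 : 0 ≤ ∫ x, f x ^ 2 ∂μ := integral_nonneg fun x => sq_nonneg _
  calc |∫ x, f x ∂μ| ^ 2 ≤ (√(μ.real Set.univ) * √(∫ x, f x ^ 2 ∂μ)) ^ 2 := by gcongr
    _ = _ := by rw [mul_pow, Real.sq_sqrt measureReal_nonneg, Real.sq_sqrt h0]

theorem integrable_mul_mul_of_bound {κ f g : α → ℝ} {C : ℝ} (hκ : AEStronglyMeasurable κ μ)
    (hC : ∀ᵐ x ∂μ, |κ x| ≤ C) (hf : MemLp f 2 μ) (hg : MemLp g 2 μ) :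
    Integrable (fun x => κ x * (f x * g x)) μ := by
  have h : Integrable (fun x => f x * g x) μ := hf.integrable_mul hg
  exact h.bdd_mul hκ (by simpa using hC)

theorem abs_integral_mul_mul_le {κ f g : α → ℝ} {C : ℝ}
    (hC : ∀ᵐ x ∂μ, |κ x| ≤ C) (hf : MemLp f 2 μ) (hg : MemLp g 2 μ) :
    |∫ x, κ x * (f x * g x) ∂μ| ≤ C * ∫ x, |f x| * |g x| ∂μ := by
  have h : Integrable (fun x => |f x| * |g x|) μ := hf.abs.integrable_mul hg.abs
  rw [← integral_const_mul, ← Real.norm_eq_abs]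
  refine norm_integral_le_of_norm_le (h.const_mul C) ?_
  filter_upwards [hC] with x hx
  rw [Real.norm_eq_abs, abs_mul, abs_mul]
  gcongr

end CauchySchwarz

/-! ### The weighted difference and the kernel -/

variable {n : ℕ} {Ω : Set (E n)} {δ : ℝ} {A : ℝ → ℝ} {ρlo ρhi γ : ℝ}

/-- Lebesgue measure on `Ω_δ × Ω_δ`. -/
noncomputable abbrev pairD {n : ℕ} (Ω : Set (E n)) (δ : ℝ) : Measure (E n × E n) :=
  (volD Ω δ).prod (volD Ω δ)

/-- The weight `√A(|x - x'|) / |x - x'|`; it takes the junk value `0` on the diagonal. -/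
noncomputable def weight {n : ℕ} (A : ℝ → ℝ) (z : E n × E n) : ℝ :=
  √(A ‖z.1 - z.2‖) / ‖z.1 - z.2‖

/-- The weighted difference `√A(|x - x'|) (u x - u x') / |x - x'|`, a square root of the energy
density: `a_{δ,κ}(u, v)` is the `L²(Ω_δ × Ω_δ)` pairing of `κ • diffQuot A u` and `diffQuot A v`. -/
noncomputable def diffQuot {n : ℕ} (A : ℝ → ℝ) (u : E n → ℝ) (z : E n × E n) : ℝ :=
  weight A z * (u z.1 - u z.2)


theorem weight_nonneg (z : E n × E n) : 0 ≤ weight A z := by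
  unfold weight; positivity

theorem IsKernel.formIntegrand_eq (hA : IsKernel n δ A) (κ : E n → E n → ℝ) (u v : E n → ℝ)
    (z : E n × E n) :
    formIntegrand A κ u v z = κ z.1 z.2 * (diffQuot A u z * diffQuot A v z) := by
  have h := Real.mul_self_sqrt (hA.nonneg ‖z.1 - z.2‖ (norm_nonneg _))
  unfold formIntegrand diffQuot weight
  rw [← h, Real.sqrt_mul_self (Real.sqrt_nonneg _)]
  ring

theorem IsKernel.form_eq (hA : IsKernel n δ A) (κ : E n → E n → ℝ) (u v : E n → ℝ) :
    form Ω δ A κ u v = ∫ z, κ z.1 z.2 * (diffQuot A u z * diffQuot A v z) ∂(pairD Ω δ) := by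
  unfold form
  exact integral_congr_ae (ae_of_all _ fun z => hA.formIntegrand_eq κ u v z)

theorem IsKernel.form_unit_eq (hA : IsKernel n δ A) (u : E n → ℝ) :
    form Ω δ A unitCond u u = ∫ z, diffQuot A u z ^ 2 ∂(pairD Ω δ) := by
  rw [hA.form_eq]
  simp only [unitCond, one_mul, sq]

theorem isFiniteMeasure_volD (hΩ : Bornology.IsBounded Ω) : IsFiniteMeasure (volD Ω δ) := by
  refine ⟨?_⟩
  rw [Measure.restrict_apply_univ]
  exact hΩ.thickening.measure_lt_top

theorem IsKernel.integrable_kernel (hA : IsKernel n δ A) (hΩ : Bornology.IsBounded Ω) :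
    Integrable (fun z : E n × E n => A ‖z.1 - z.2‖) (pairD Ω δ) := by
  have := isFiniteMeasure_volD (δ := δ) hΩ
  have h := Integrable.convolution_integrand (ContinuousLinearMap.mul ℝ ℝ)
    (integrable_const (1 : ℝ) : Integrable (fun _ : E n => (1 : ℝ)) (volD Ω δ)) hA.integrable
  simp only [ContinuousLinearMap.mul_apply', one_mul] at h
  exact h.mono_measure (Measure.prod_mono Measure.restrict_le_self le_rfl)

theorem IsKernel.aestronglyMeasurable_weight (hA : IsKernel n δ A) (hΩ : Bornology.IsBounded Ω) :
    AEStronglyMeasurable (weight A) (pairD Ω δ) := by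
  have h1 := (hA.integrable_kernel hΩ).aestronglyMeasurable.aemeasurable
  have h2 : Measurable (fun z : E n × E n => ‖z.1 - z.2‖) := by fun_prop
  exact (h1.sqrt.div h2.aemeasurable).aestronglyMeasurable

theorem ae_fst {p : E n → Prop} (h : ∀ᵐ x ∂(volD Ω δ), p x) : ∀ᵐ z ∂(pairD Ω δ), p z.1 :=
  Measure.quasiMeasurePreserving_fst.ae h

theorem ae_snd {p : E n → Prop} (h : ∀ᵐ x ∂(volD Ω δ), p x) : ∀ᵐ z ∂(pairD Ω δ), p z.2 :=
  Measure.quasiMeasurePreserving_snd.ae h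

theorem diffQuot_congr {u v : E n → ℝ} (h : u =ᵐ[volD Ω δ] v) :
    diffQuot A u =ᵐ[pairD Ω δ] diffQuot A v := by
  filter_upwards [ae_fst h, ae_snd h] with z h1 h2
  simp only [diffQuot, h1, h2]

theorem diffQuot_add (u v : E n → ℝ) (z : E n × E n) :
    diffQuot A (fun x => u x + v x) z = diffQuot A u z + diffQuot A v z := by
  simp only [diffQuot]; ring

theorem diffQuot_sub (u v : E n → ℝ) (z : E n × E n) :
    diffQuot A (fun x => u x - v x) z = diffQuot A u z - diffQuot A v z := by
  simp only [diffQuot]; ring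

theorem diffQuot_const_mul (c : ℝ) (u : E n → ℝ) (z : E n × E n) :
    diffQuot A (fun x => c * u x) z = c * diffQuot A u z := by
  simp only [diffQuot]; ring

theorem IsKernel.aestronglyMeasurable_diffQuot (hA : IsKernel n δ A) (hΩ : Bornology.IsBounded Ω)
    {u : E n → ℝ} (hu : AEStronglyMeasurable u (volD Ω δ)) :
    AEStronglyMeasurable (diffQuot A u) (pairD Ω δ) :=
  (hA.aestronglyMeasurable_weight hΩ).mul (hu.comp_fst.sub hu.comp_snd)

/-- Membership in the energy space is square integrability of the weighted difference. -/
theorem IsKernel.mem_energySpace_iff (hA : IsKernel n δ A) (hΩ : Bornology.IsBounded Ω)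
    (u : StateSpace Ω δ) :
    u ∈ energySpace Ω δ A ↔ MemLp (diffQuot A u) 2 (pairD Ω δ) := by
  rw [memLp_two_iff_integrable_sq
    (hA.aestronglyMeasurable_diffQuot hΩ (Lp.aestronglyMeasurable u))]
  refine integrable_congr (ae_of_all _ fun z => ?_)
  dsimp only
  rw [hA.formIntegrand_eq, unitCond, one_mul, sq]

/-- Test functions have finite energy: they are Lipschitz, so their energy density is bounded by a
multiple of `A(|x - x'|)`. -/
theorem IsTestFunction.memLp_diffQuot (hA : IsKernel n δ A) (hΩ : Bornology.IsBounded Ω)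
    {φ : E n → ℝ} (hφ : IsTestFunction Ω φ) : MemLp (diffQuot A φ) 2 (pairD Ω δ) := by
  obtain ⟨hsmooth, hsupp, -⟩ := hφ
  obtain ⟨K, hK⟩ := hsmooth.lipschitzWith_of_hasCompactSupport hsupp (by simp)
  have hm := hA.aestronglyMeasurable_diffQuot (δ := δ) hΩ
    hsmooth.continuous.aestronglyMeasurable
  rw [memLp_two_iff_integrable_sq hm]
  refine ((hA.integrable_kernel hΩ).const_mul ((K : ℝ) ^ 2)).mono' (hm.pow 2) (ae_of_all _ ?_)
  intro z
  rw [Real.norm_of_nonneg (sq_nonneg _)]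
  have hA0 := hA.nonneg ‖z.1 - z.2‖ (norm_nonneg _)
  have h1 : |φ z.1 - φ z.2| ≤ K * ‖z.1 - z.2‖ := by
    simpa [Real.dist_eq, dist_eq_norm] using hK.dist_le_mul z.1 z.2
  have h2 : (φ z.1 - φ z.2) ^ 2 ≤ (K * ‖z.1 - z.2‖) ^ 2 := by
    rw [← sq_abs]; gcongr
  unfold diffQuot weight
  rcases eq_or_ne ‖z.1 - z.2‖ 0 with h0 | h0
  · simp only [h0, div_zero, zero_mul, ne_eq, OfNat.ofNat_ne_zero, not_false_eq_true, zero_pow]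
    rw [h0] at hA0
    positivity
  · calc (√(A ‖z.1 - z.2‖) / ‖z.1 - z.2‖ * (φ z.1 - φ z.2)) ^ 2
        = A ‖z.1 - z.2‖ / ‖z.1 - z.2‖ ^ 2 * (φ z.1 - φ z.2) ^ 2 := by
          rw [mul_pow, div_pow, Real.sq_sqrt hA0]
      _ ≤ A ‖z.1 - z.2‖ / ‖z.1 - z.2‖ ^ 2 * (K * ‖z.1 - z.2‖) ^ 2 := by gcongr
      _ = (K : ℝ) ^ 2 * A ‖z.1 - z.2‖ := by field_simp

theorem IsTestFunction.memLp {φ : E n → ℝ} (hφ : IsTestFunction Ω φ) :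
    MemLp φ 2 (volD Ω δ) :=
  (hφ.1.continuous.memLp_of_hasCompactSupport hφ.2.1).restrict _

/-- The lower bound on the kernel controls differences of nearby values by the energy density. The
factor `ε ^ (n + 2 s)`, which beats the volume of a ball of radius `ε`, drives the compactness
argument. -/
theorem IsKernel.exists_sq_sub_le (hA : IsKernel n δ A) :
    ∃ s : ℝ, 0 < s ∧ ∃ C : ℝ, 0 < C ∧ ∀ ε : ℝ, 0 < ε → ε ≤ δ / 2 →
      ∀ (u : E n → ℝ) (x y : E n), ‖x - y‖ < ε →
        (u x - u y) ^ 2 ≤ C * ε ^ ((n : ℝ) + 2 * s) * diffQuot A u (x, y) ^ 2 := by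
  obtain ⟨s, hs, -, c, hc, hbound⟩ := hA.lower_bound
  refine ⟨s, hs, c⁻¹, inv_pos.2 hc, fun ε hε hεδ u x y hxy => ?_⟩
  rcases eq_or_ne x y with rfl | hne
  · simp only [sub_self, ne_eq, OfNat.ofNat_ne_zero, not_false_eq_true, zero_pow]
    positivity
  have hr : 0 < ‖x - y‖ := norm_pos_iff.2 (sub_ne_zero.2 hne)
  have h := hbound (x - y) (by simpa using hxy.trans_le hεδ) (sub_ne_zero.2 hne)
  have hA0 := hA.nonneg ‖x - y‖ (norm_nonneg _)
  have hpow : ‖x - y‖ ^ ((n : ℝ) + 2 * s) =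
      ‖x - y‖ ^ ((n : ℝ) + 2 * s - 2) * ‖x - y‖ ^ 2 := by
    rw [← Real.rpow_natCast, ← Real.rpow_add hr]
    congr 1
    push_cast
    ring
  have hle : ‖x - y‖ ^ ((n : ℝ) + 2 * s) ≤ ε ^ ((n : ℝ) + 2 * s) := by gcongr
  have hone : 1 ≤ c⁻¹ * ε ^ ((n : ℝ) + 2 * s) * (A ‖x - y‖ / ‖x - y‖ ^ 2) := by
    rw [div_le_iff₀ (by positivity)] at h
    calc (1 : ℝ) = c⁻¹ * (c / ‖x - y‖ ^ 2) * ‖x - y‖ ^ 2 := by field_simp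
      _ ≤ c⁻¹ * (A ‖x - y‖ * ‖x - y‖ ^ ((n : ℝ) + 2 * s - 2) / ‖x - y‖ ^ 2) * ‖x - y‖ ^ 2 := by
        gcongr
      _ = c⁻¹ * ‖x - y‖ ^ ((n : ℝ) + 2 * s) * (A ‖x - y‖ / ‖x - y‖ ^ 2) := by
        rw [hpow]; field_simp
      _ ≤ _ := by gcongr
  have hd : diffQuot A u (x, y) ^ 2 = A ‖x - y‖ / ‖x - y‖ ^ 2 * (u x - u y) ^ 2 := by
    unfold diffQuot weight
    rw [mul_pow, div_pow, Real.sq_sqrt hA0]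
  rw [hd]
  nlinarith [mul_le_mul_of_nonneg_right hone (sq_nonneg (u x - u y))]

/-! ### The nonlocal Poincaré inequality -/

/-- A translation by `m • h` is `m` successive translations by `h`. -/
theorem lintegral_sq_sub_nsmul_le {U : E n → ℝ} (hU : Measurable U) (h : E n) (m : ℕ) :
    ∫⁻ x, ENNReal.ofReal ((U (x + m • h) - U x) ^ 2) ≤
      (m : ℝ≥0∞) ^ 2 * ∫⁻ x, ENNReal.ofReal ((U (x + h) - U x) ^ 2) := by
  have hpt : ∀ x, ENNReal.ofReal ((U (x + m • h) - U x) ^ 2) ≤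
      m * ∑ j ∈ Finset.range m, ENNReal.ofReal ((U (x + j • h + h) - U (x + j • h)) ^ 2) := by
    intro x
    have h1 : U (x + m • h) - U x =
        ∑ j ∈ Finset.range m, (U (x + j • h + h) - U (x + j • h)) := by
      have := Finset.sum_range_sub (fun j : ℕ => U (x + j • h)) m
      simp only [zero_smul, add_zero, succ_nsmul, ← add_assoc] at this
      exact this.symm
    rw [← ENNReal.ofReal_sum_of_nonneg (fun _ _ => sq_nonneg _), ← ENNReal.ofReal_natCast,
      ← ENNReal.ofReal_mul (Nat.cast_nonneg m), h1]
    refine ENNReal.ofReal_le_ofReal ?_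
    simpa using sq_sum_le_card_mul_sum_sq (s := Finset.range m)
      (f := fun j : ℕ => U (x + j • h + h) - U (x + j • h))
  have hmeas : Measurable fun x => ENNReal.ofReal ((U (x + h) - U x) ^ 2) := by fun_prop
  calc ∫⁻ x, ENNReal.ofReal ((U (x + m • h) - U x) ^ 2)
      ≤ ∫⁻ x, m * ∑ j ∈ Finset.range m,
          ENNReal.ofReal ((U (x + j • h + h) - U (x + j • h)) ^ 2) := lintegral_mono hpt
    _ = m * ∑ j ∈ Finset.range m,
          ∫⁻ x, ENNReal.ofReal ((U (x + j • h + h) - U (x + j • h)) ^ 2) := by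
        rw [lintegral_const_mul _ (by fun_prop), lintegral_finsetSum _ (fun j _ => by fun_prop)]
    _ = m * ∑ _j ∈ Finset.range m, ∫⁻ x, ENNReal.ofReal ((U (x + h) - U x) ^ 2) := by
        congr 1
        refine Finset.sum_congr rfl fun j _ => ?_
        exact lintegral_add_right_eq_self
          (fun x => ENNReal.ofReal ((U (x + h) - U x) ^ 2)) (j • h)
    _ = _ := by
        rw [Finset.sum_const, Finset.card_range, nsmul_eq_mul, sq, mul_assoc]

theorem sq_le_sq_sub_of_translate_notMem {U : E n → ℝ} (hU0 : ∀ x, x ∉ Ω → U x = 0) {k : E n}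
    (hk : ∀ x ∈ Ω, x + k ∉ Ω) (x : E n) : U x ^ 2 ≤ (U (x + k) - U x) ^ 2 := by
  by_cases hx : x ∈ Ω
  · rw [hU0 _ (hk x hx)]
    simp
  · rw [hU0 x hx]
    simp only [ne_eq, OfNat.ofNat_ne_zero, not_false_eq_true, zero_pow]
    positivity

theorem measurableSet_thickening : MeasurableSet (Metric.thickening δ Ω) :=
  Metric.isOpen_thickening.measurableSet

theorem mem_thickening_of_norm_sub_lt {x y : E n} (hx : x ∈ Ω) (hxy : ‖x - y‖ < δ) :
    y ∈ Metric.thickening δ Ω := by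
  rw [Metric.mem_thickening_iff]
  exact ⟨x, hx, by rwa [dist_comm, dist_eq_norm]⟩

/-- The part of the double integral over differences `h` in a set of vectors shorter than `δ / 2`
is controlled by the energy. -/
theorem IsKernel.exists_lintegral_translate_le (hA : IsKernel n δ A) (hδ : 0 < δ) :
    ∃ C : ℝ≥0∞, C ≠ ⊤ ∧ ∀ (S : Set (E n)), MeasurableSet S → S ⊆ Metric.ball 0 (δ / 2) →
      ∀ U : E n → ℝ, Measurable U → (∀ x, x ∉ Ω → U x = 0) →
      ∫⁻ h in S, ∫⁻ x, ENNReal.ofReal ((U (x + h) - U x) ^ 2) ≤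
        C * ∫⁻ z, ENNReal.ofReal (diffQuot A U z ^ 2) ∂(pairD Ω δ) := by
  obtain ⟨s, -, C, hC, hbound⟩ := hA.exists_sq_sub_le
  have hδ2 : 0 < δ / 2 := by positivity
  refine ⟨ENNReal.ofReal (C * (δ / 2) ^ ((n : ℝ) + 2 * s)), ENNReal.ofReal_ne_top,
    fun S hS hSsub U hU hU0 => ?_⟩
  set F : E n × E n → ℝ≥0∞ := fun z =>
    S.indicator (fun _ => ENNReal.ofReal ((U z.2 - U z.1) ^ 2)) (z.2 - z.1) with hF
  have hFm : Measurable F := by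
    have h1 : MeasurableSet {z : E n × E n | z.2 - z.1 ∈ S} :=
      hS.preimage (measurable_snd.sub measurable_fst)
    have h2 : F = {z : E n × E n | z.2 - z.1 ∈ S}.indicator
        (fun z => ENNReal.ofReal ((U z.2 - U z.1) ^ 2)) := by
      ext z
      by_cases hz : z.2 - z.1 ∈ S <;> simp [hF, hz]
    rw [h2]
    exact Measurable.indicator (by fun_prop) h1
  have hstep : ∫⁻ h in S, ∫⁻ x, ENNReal.ofReal ((U (x + h) - U x) ^ 2) = ∫⁻ z, F z := by
    rw [Measure.volume_eq_prod, lintegral_prod _ hFm.aemeasurable,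
      lintegral_lintegral_swap (by fun_prop)]
    refine lintegral_congr fun x => ?_
    rw [← lintegral_indicator hS, ← lintegral_sub_right_eq_self _ x]
    refine lintegral_congr fun y => ?_
    by_cases hz : y - x ∈ S <;> simp [hF, hz]
  have hpair : pairD Ω δ =
      volume.restrict (Metric.thickening δ Ω ×ˢ Metric.thickening δ Ω) := by
    rw [Measure.volume_eq_prod, pairD, volD, Measure.prod_restrict]
  rw [hstep, ← lintegral_const_mul' _ _ ENNReal.ofReal_ne_top, hpair,
    ← lintegral_indicator (measurableSet_thickening.prod measurableSet_thickening)]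
  refine lintegral_mono fun z => ?_
  by_cases hz : z.2 - z.1 ∈ S
  swap
  · simp only [hF, Set.indicator_of_notMem hz, zero_le]
  have hlt : ‖z.1 - z.2‖ < δ / 2 := by
    rw [norm_sub_rev]
    simpa using hSsub hz
  by_cases hΩz : z.1 ∈ Ω ∨ z.2 ∈ Ω
  · -- a point of `Ω` at distance less than `δ` puts both points into `Ω_δ`
    have hmem : z ∈ Metric.thickening δ Ω ×ˢ Metric.thickening δ Ω := by
      rcases hΩz with h | h
      · exact ⟨Metric.self_subset_thickening hδ _ h,
          mem_thickening_of_norm_sub_lt h (by linarith)⟩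
      · exact ⟨mem_thickening_of_norm_sub_lt h (by rw [norm_sub_rev]; linarith),
          Metric.self_subset_thickening hδ _ h⟩
    rw [Set.indicator_of_mem hmem, hF]
    dsimp only
    rw [Set.indicator_of_mem hz, ← ENNReal.ofReal_mul (by positivity)]
    refine ENNReal.ofReal_le_ofReal ?_
    rw [← neg_sub, neg_sq]
    exact hbound (δ / 2) hδ2 le_rfl U z.1 z.2 hlt
  · push Not at hΩz
    simp only [hF, Set.indicator_of_mem hz, hU0 _ hΩz.1, hU0 _ hΩz.2, sub_self, ne_eq,
      OfNat.ofNat_ne_zero, not_false_eq_true, zero_pow, ENNReal.ofReal_zero, zero_le]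

/-- The nonlocal Poincaré inequality for functions that vanish off the bounded set `Ω`, in terms of
lower integrals. For every `h` with `δ / 4 < |h| < δ / 2` finitely many translations by `h` move
`Ω` off itself, so `∫ U ^ 2` is at most `m ^ 2 ∫ (U (x + h) - U x) ^ 2 dx`; integrating over these
`h` gives the energy. -/
theorem IsKernel.exists_lintegral_poincare (hA : IsKernel n δ A) (hn : 2 ≤ n)
    (hΩ : Bornology.IsBounded Ω) (hδ : 0 < δ) :
    ∃ C : ℝ≥0∞, C ≠ ⊤ ∧ ∀ U : E n → ℝ, Measurable U → (∀ x, x ∉ Ω → U x = 0) →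
      ∫⁻ x, ENNReal.ofReal (U x ^ 2) ≤
        C * ∫⁻ z, ENNReal.ofReal (diffQuot A U z ^ 2) ∂(pairD Ω δ) := by
  obtain ⟨C, hC, hbound⟩ := hA.exists_lintegral_translate_le (Ω := Ω) hδ
  obtain ⟨R, hR⟩ := Metric.isBounded_iff.1 hΩ
  obtain ⟨m, hm⟩ := exists_nat_gt (R / (δ / 4))
  rw [div_lt_iff₀ (by positivity)] at hm
  set S : Set (E n) := {h | δ / 4 < ‖h‖ ∧ ‖h‖ < δ / 2} with hS
  have hSo : IsOpen S := (isOpen_lt continuous_const continuous_norm).inter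
    (isOpen_lt continuous_norm continuous_const)
  have hSsub : S ⊆ Metric.ball 0 (δ / 2) := fun h hh => by simpa using hh.2
  have : Nonempty (Fin n) := ⟨⟨0, by omega⟩⟩
  have hSne : S.Nonempty := by
    obtain ⟨h, hh⟩ := exists_norm_eq (E n) (show 0 ≤ 3 * δ / 8 by positivity)
    exact ⟨h, by rw [hh]; linarith, by rw [hh]; linarith⟩
  have hS0 : volume S ≠ 0 := (hSo.measure_pos volume hSne).ne'
  have hStop : volume S ≠ ⊤ := ((measure_mono hSsub).trans_lt measure_ball_lt_top).ne
  refine ⟨(volume S)⁻¹ * ((m : ℝ≥0∞) ^ 2 * C), by finiteness, fun U hU hU0 => ?_⟩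
  have hN : ∀ h ∈ S, ∫⁻ x, ENNReal.ofReal (U x ^ 2) ≤
      (m : ℝ≥0∞) ^ 2 * ∫⁻ x, ENNReal.ofReal ((U (x + h) - U x) ^ 2) := by
    intro h hh
    refine le_trans (lintegral_mono fun x => ENNReal.ofReal_le_ofReal ?_)
      (lintegral_sq_sub_nsmul_le hU h m)
    refine sq_le_sq_sub_of_translate_notMem hU0 (fun y hy hyk => ?_) x
    have h1 := hR hyk hy
    rw [dist_eq_norm, add_sub_cancel_left, ← Nat.cast_smul_eq_nsmul ℝ, norm_smul,
      Real.norm_natCast] at h1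
    have h2 : (m : ℝ) * (δ / 4) ≤ m * ‖h‖ := by gcongr; exact hh.1.le
    linarith
  have key : volume S * ∫⁻ x, ENNReal.ofReal (U x ^ 2) ≤
      (m : ℝ≥0∞) ^ 2 * (C * ∫⁻ z, ENNReal.ofReal (diffQuot A U z ^ 2) ∂(pairD Ω δ)) := by
    calc volume S * ∫⁻ x, ENNReal.ofReal (U x ^ 2)
        = ∫⁻ _h in S, ∫⁻ x, ENNReal.ofReal (U x ^ 2) := by
          rw [setLIntegral_const, mul_comm]
      _ ≤ ∫⁻ h in S, (m : ℝ≥0∞) ^ 2 * ∫⁻ x, ENNReal.ofReal ((U (x + h) - U x) ^ 2) :=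
          setLIntegral_mono' hSo.measurableSet hN
      _ = (m : ℝ≥0∞) ^ 2 * ∫⁻ h in S, ∫⁻ x, ENNReal.ofReal ((U (x + h) - U x) ^ 2) :=
          lintegral_const_mul' _ _ (by finiteness)
      _ ≤ _ := by gcongr; exact hbound S hSo.measurableSet hSsub U hU hU0
  calc ∫⁻ x, ENNReal.ofReal (U x ^ 2)
      = (volume S)⁻¹ * (volume S * ∫⁻ x, ENNReal.ofReal (U x ^ 2)) := by
        rw [← mul_assoc, ENNReal.inv_mul_cancel hS0 hStop, one_mul]
    _ ≤ (volume S)⁻¹ * ((m : ℝ≥0∞) ^ 2 *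
          (C * ∫⁻ z, ENNReal.ofReal (diffQuot A U z ^ 2) ∂(pairD Ω δ))) := by gcongr
    _ = _ := by simp only [mul_assoc]

/-- The nonlocal Poincaré inequality for square integrable functions that vanish almost everywhere
in `Ω_δ` off `Ω`. -/
theorem IsKernel.exists_poincare (hA : IsKernel n δ A) (hn : 2 ≤ n) (hΩo : IsOpen Ω)
    (hΩ : Bornology.IsBounded Ω) (hδ : 0 < δ) :
    ∃ C : ℝ, 0 < C ∧ ∀ u : StateSpace Ω δ, (∀ᵐ x ∂(volD Ω δ), x ∉ Ω → u x = 0) →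
      MemLp (diffQuot A u) 2 (pairD Ω δ) →
      ∫ x, u x ^ 2 ∂(volD Ω δ) ≤ C * ∫ z, diffQuot A u z ^ 2 ∂(pairD Ω δ) := by
  obtain ⟨C, hC, hP⟩ := hA.exists_lintegral_poincare hn hΩ hδ
  refine ⟨C.toReal + 1, by positivity, fun u hu hdu => ?_⟩
  set U : E n → ℝ := Ω.indicator u with hUdef
  have hU : Measurable U := (Lp.stronglyMeasurable u).measurable.indicator hΩo.measurableSet
  have hUu : U =ᵐ[volD Ω δ] u := by
    filter_upwards [hu] with x hx
    by_cases h : x ∈ Ω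
    · simp [hUdef, h]
    · simp [hUdef, h, hx h]
  have h1 : ∫⁻ x, ENNReal.ofReal (u x ^ 2) ∂(volD Ω δ) ≤ ∫⁻ x, ENNReal.ofReal (U x ^ 2) := by
    rw [lintegral_congr_ae (g := fun x => ENNReal.ofReal (U x ^ 2))
      (by filter_upwards [hUu] with x hx; rw [hx])]
    exact lintegral_mono' Measure.restrict_le_self le_rfl
  have h2 := h1.trans (hP U hU fun x hx => Set.indicator_of_notMem hx _)
  rw [lintegral_congr_ae (g := fun z => ENNReal.ofReal (diffQuot A u z ^ 2))
      (by filter_upwards [diffQuot_congr (A := A) hUu] with x hx; rw [hx]),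
    ← ofReal_integral_eq_lintegral_ofReal hdu.integrable_sq (ae_of_all _ fun _ => sq_nonneg _),
    ← ofReal_integral_eq_lintegral_ofReal (Lp.memLp u).integrable_sq
      (ae_of_all _ fun _ => sq_nonneg _)] at h2
  have h0 : 0 ≤ ∫ z, diffQuot A u z ^ 2 ∂(pairD Ω δ) := integral_nonneg fun _ => sq_nonneg _
  rw [← ENNReal.ofReal_toReal hC, ← ENNReal.ofReal_mul ENNReal.toReal_nonneg,
    ENNReal.ofReal_le_ofReal_iff (by positivity)] at h2
  linarith

/-! ### Compactness in `L²` -/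

/-- The integral of `e` over the part of the ball `B(x, ε)` that lies in `Ω_δ`. -/
noncomputable def ballIntegral (Ω : Set (E n)) (δ ε : ℝ) (e : E n → ℝ) (x : E n) : ℝ :=
  ∫ y in Metric.ball x ε, e y ∂(volD Ω δ)

theorem stronglyMeasurable_ballIntegral (hΩ : Bornology.IsBounded Ω) (ε : ℝ) (e : StateSpace Ω δ) :
    StronglyMeasurable (ballIntegral Ω δ ε e) := by
  have := isFiniteMeasure_volD (δ := δ) hΩ
  have h1 : MeasurableSet {z : E n × E n | z.2 ∈ Metric.ball z.1 ε} := by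
    have : IsOpen {z : E n × E n | z.2 ∈ Metric.ball z.1 ε} :=
      isOpen_lt (continuous_snd.dist continuous_fst) continuous_const
    exact this.measurableSet
  have h2 : StronglyMeasurable fun z : E n × E n =>
      {z : E n × E n | z.2 ∈ Metric.ball z.1 ε}.indicator (fun z => e z.2) z :=
    ((Lp.stronglyMeasurable e).comp_measurable measurable_snd).indicator h1
  have h3 := h2.integral_prod_right' (ν := volD Ω δ)
  convert h3 using 1
  ext x
  rw [ballIntegral, ← integral_indicator Metric.isOpen_ball.measurableSet]
  refine integral_congr_ae (ae_of_all _ fun y => ?_)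
  by_cases hy : y ∈ Metric.ball x ε
  · exact (Set.indicator_of_mem hy _).trans (Set.indicator_of_mem (a := (x, y))
      (s := {z : E n × E n | z.2 ∈ Metric.ball z.1 ε}) hy fun z => e z.2).symm
  · exact (Set.indicator_of_notMem hy _).trans (Set.indicator_of_notMem (a := (x, y))
      (s := {z : E n × E n | z.2 ∈ Metric.ball z.1 ε}) hy fun z => e z.2).symm

theorem sq_ballIntegral_le (hΩ : Bornology.IsBounded Ω) (ε : ℝ) (e : StateSpace Ω δ) (x : E n) :
    ballIntegral Ω δ ε e x ^ 2 ≤ (volD Ω δ).real Set.univ * ‖e‖ ^ 2 := by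
  have := isFiniteMeasure_volD (δ := δ) hΩ
  refine (sq_integral_le ((Lp.memLp e).restrict _)).trans ?_
  rw [norm_sq_eq_integral, measureReal_restrict_apply MeasurableSet.univ, Set.univ_inter]
  refine mul_le_mul (measureReal_mono (Set.subset_univ _)) ?_
    (integral_nonneg fun _ => sq_nonneg _) measureReal_nonneg
  exact setIntegral_le_integral (Lp.memLp e).integrable_sq (ae_of_all _ fun _ => sq_nonneg _)

/-- Ball averages of a weakly null bounded sequence tend to zero in `L²`. -/
theorem tendsto_integral_sq_ballIntegral (hΩ : Bornology.IsBounded Ω) (ε : ℝ)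
    {e : ℕ → StateSpace Ω δ} {K : ℝ} (hK : ∀ k, ‖e k‖ ≤ K)
    (hw : ∀ v : StateSpace Ω δ, Tendsto (fun k => ⟪e k, v⟫) atTop (𝓝 0)) :
    Tendsto (fun k => ∫ x, ballIntegral Ω δ ε (e k) x ^ 2 ∂(volD Ω δ)) atTop (𝓝 0) := by
  have := isFiniteMeasure_volD (δ := δ) hΩ
  have h := tendsto_integral_of_dominated_convergence (μ := volD Ω δ)
    (F := fun k x => ballIntegral Ω δ ε (e k) x ^ 2) (f := fun _ => 0)
    (fun _ => (volD Ω δ).real Set.univ * K ^ 2)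
    (fun k => ((stronglyMeasurable_ballIntegral hΩ ε (e k)).pow 2).aestronglyMeasurable)
    (integrable_const _)
    (fun k => ae_of_all _ fun x => by
      rw [Real.norm_of_nonneg (sq_nonneg _)]
      refine (sq_ballIntegral_le hΩ ε (e k) x).trans ?_
      gcongr
      exact hK k)
    (ae_of_all _ fun x => by
      have h1 : ∀ k, ballIntegral Ω δ ε (e k) x = ⟪e k, indicatorConstLp 2
          (Metric.isOpen_ball (x := x) (ε := ε)).measurableSet
          (measure_ne_top (volD Ω δ) _) (1 : ℝ)⟫ := by
        intro k
        rw [real_inner_comm, L2.inner_indicatorConstLp_one]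
        rfl
      have h2 := (hw (indicatorConstLp 2 (Metric.isOpen_ball (x := x) (ε := ε)).measurableSet
          (measure_ne_top (volD Ω δ) _) (1 : ℝ))).pow 2
      simp only [h1]
      simpa using h2)
  simpa using h

/-- A function vanishing off `Ω` is controlled in `L²` by its averages over balls of radius `ε` and
by its energy, with a factor `ε ^ (2 s)` in front of the energy. -/
theorem IsKernel.exists_integral_sq_le (hA : IsKernel n δ A) (hn : 2 ≤ n)
    (hΩ : Bornology.IsBounded Ω) :
    ∃ s : ℝ, 0 < s ∧ ∃ C : ℝ, 0 < C ∧ ∀ ε : ℝ, 0 < ε → ε ≤ δ / 2 → ∃ b : ℝ, 0 < b ∧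
      ∀ e : StateSpace Ω δ, (∀ᵐ x ∂(volD Ω δ), x ∉ Ω → e x = 0) →
      MemLp (diffQuot A e) 2 (pairD Ω δ) →
      ∫ x, e x ^ 2 ∂(volD Ω δ) ≤ b * ∫ x, ballIntegral Ω δ ε e x ^ 2 ∂(volD Ω δ) +
        C * ε ^ (2 * s) * ∫ z, diffQuot A e z ^ 2 ∂(pairD Ω δ) := by
  have := isFiniteMeasure_volD (δ := δ) hΩ
  have : Nonempty (Fin n) := ⟨⟨0, by omega⟩⟩
  obtain ⟨s, hs, C, hC, hbound⟩ := hA.exists_sq_sub_le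
  have hβ : 0 < (volume : Measure (E n)).real (Metric.ball 0 1) :=
    ENNReal.toReal_pos (Metric.measure_ball_pos _ _ one_pos).ne' measure_ball_lt_top.ne
  set β := (volume : Measure (E n)).real (Metric.ball 0 1)
  refine ⟨s, hs, 2 * C / β, by positivity, fun ε hε hεδ => ?_⟩
  set b := β * ε ^ n with hb
  have hb0 : 0 < b := by positivity
  refine ⟨2 / b ^ 2, by positivity, fun e he hD => ?_⟩
  have hball : ∀ x ∈ Ω, (volD Ω δ).real (Metric.ball x ε) = b := by
    intro x hx
    have hsub : Metric.ball x ε ⊆ Metric.thickening δ Ω := fun y hy =>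
      mem_thickening_of_norm_sub_lt hx (by
        rw [← dist_eq_norm, dist_comm]
        linarith [Metric.mem_ball.1 hy])
    rw [measureReal_restrict_apply Metric.isOpen_ball.measurableSet,
      Set.inter_eq_self_of_subset_left hsub, measureReal_def, Measure.addHaar_ball _ _ hε.le,
      ENNReal.toReal_mul, ENNReal.toReal_ofReal (by positivity), finrank_euclideanSpace_fin, hb,
      mul_comm]
    rfl
  have hDi : Integrable (fun z => diffQuot A e z ^ 2) ((volD Ω δ).prod (volD Ω δ)) :=
    hD.integrable_sq
  have hpt : ∀ᵐ x ∂(volD Ω δ), b ^ 2 * e x ^ 2 ≤ 2 * ballIntegral Ω δ ε e x ^ 2 +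
      2 * b * (C * ε ^ ((n : ℝ) + 2 * s)) * ∫ y, diffQuot A e (x, y) ^ 2 ∂(volD Ω δ) := by
    filter_upwards [he, hDi.prod_right_ae] with x hx hxi
    have hI0 : 0 ≤ ∫ y, diffQuot A e (x, y) ^ 2 ∂(volD Ω δ) :=
      integral_nonneg fun _ => sq_nonneg _
    by_cases hxΩ : x ∈ Ω
    swap
    · rw [hx hxΩ]
      simp only [ne_eq, OfNat.ofNat_ne_zero, not_false_eq_true, zero_pow, mul_zero]
      positivity
    set ν := (volD Ω δ).restrict (Metric.ball x ε) with hν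
    have heν : MemLp e 2 ν := (Lp.memLp e).restrict _
    have hdν : MemLp (fun y => e x - e y) 2 ν := (memLp_const (e x)).sub heν
    have hνuniv : ν.real Set.univ = b := by
      rw [measureReal_restrict_apply MeasurableSet.univ, Set.univ_inter, hball x hxΩ]
    have h1 : b * e x = ballIntegral Ω δ ε e x + ∫ y, (e x - e y) ∂ν := by
      rw [integral_sub (integrable_const _) (heν.integrable one_le_two), integral_const, hνuniv,
        ballIntegral, smul_eq_mul]
      ring
    have h2 := sq_integral_le hdν
    rw [hνuniv] at h2
    have h3 : ∫ y, (e x - e y) ^ 2 ∂ν ≤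
        C * ε ^ ((n : ℝ) + 2 * s) * ∫ y, diffQuot A e (x, y) ^ 2 ∂(volD Ω δ) := by
      rw [← integral_const_mul]
      refine le_trans (setIntegral_mono_on hdν.integrable_sq (hxi.const_mul _).integrableOn
        Metric.isOpen_ball.measurableSet fun y hy => ?_)
        (setIntegral_le_integral (hxi.const_mul _) (ae_of_all _ fun y => ?_))
      · exact hbound ε hε hεδ e x y (by rwa [← dist_eq_norm, dist_comm])
      · simp only [Pi.zero_apply]
        positivity
    have h4 : b ^ 2 * e x ^ 2 ≤ 2 * ballIntegral Ω δ ε e x ^ 2 +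
        2 * (∫ y, (e x - e y) ∂ν) ^ 2 := by
      rw [← mul_pow, h1]
      nlinarith [sq_nonneg (ballIntegral Ω δ ε e x - ∫ y, (e x - e y) ∂ν)]
    have h5 := mul_le_mul_of_nonneg_left h3 hb0.le
    nlinarith
  have hTi : Integrable (fun x => ballIntegral Ω δ ε e x ^ 2) (volD Ω δ) := by
    refine (integrable_const ((volD Ω δ).real Set.univ * ‖e‖ ^ 2)).mono'
      ((stronglyMeasurable_ballIntegral hΩ ε e).pow 2).aestronglyMeasurable (ae_of_all _ fun x => ?_)
    rw [Real.norm_of_nonneg (sq_nonneg _)]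
    exact sq_ballIntegral_le hΩ ε e x
  have hint := integral_mono_ae ((Lp.memLp e).integrable_sq.const_mul (b ^ 2))
    ((hTi.const_mul 2).add (hDi.integral_prod_left.const_mul
      (2 * b * (C * ε ^ ((n : ℝ) + 2 * s))))) hpt
  simp only [Pi.add_apply] at hint
  rw [integral_add (hTi.const_mul 2) (hDi.integral_prod_left.const_mul _)] at hint
  simp only [integral_const_mul] at hint
  rw [← integral_prod _ hDi] at hint
  have hpow : ε ^ ((n : ℝ) + 2 * s) = ε ^ n * ε ^ (2 * s) := by
    rw [Real.rpow_add hε, Real.rpow_natCast]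
  rw [hpow] at hint
  rw [← mul_le_mul_iff_right₀ (show 0 < b ^ 2 by positivity)]
  refine hint.trans (le_of_eq ?_)
  rw [hb]
  field_simp

/-- The compactness of the embedding of the state space into `L²(Ω_δ)`, for weakly null
sequences. -/
theorem IsKernel.tendsto_norm_of_weak (hA : IsKernel n δ A) (hn : 2 ≤ n)
    (hΩ : Bornology.IsBounded Ω) (hδ : 0 < δ) {e : ℕ → StateSpace Ω δ} {K M : ℝ}
    (he : ∀ k, ∀ᵐ x ∂(volD Ω δ), x ∉ Ω → e k x = 0)
    (hD : ∀ k, MemLp (diffQuot A (e k)) 2 (pairD Ω δ))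
    (hM : ∀ k, ∫ z, diffQuot A (e k) z ^ 2 ∂(pairD Ω δ) ≤ M) (hK : ∀ k, ‖e k‖ ≤ K)
    (hw : ∀ v : StateSpace Ω δ, Tendsto (fun k => ⟪e k, v⟫) atTop (𝓝 0)) :
    Tendsto (fun k => ‖e k‖) atTop (𝓝 0) := by
  suffices h : Tendsto (fun k => ‖e k‖ ^ 2) atTop (𝓝 0) by
    simpa using h.sqrt
  obtain ⟨s, hs, C, hC, hbound⟩ := hA.exists_integral_sq_le hn hΩ
  rw [Metric.tendsto_atTop']
  intro η hη
  obtain ⟨ε, hε, hεδ, hεη⟩ : ∃ ε : ℝ, 0 < ε ∧ ε ≤ δ / 2 ∧ C * ε ^ (2 * s) * M < η / 2 := by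
    have h1 : Tendsto (fun ε : ℝ => C * ε ^ (2 * s) * M) (𝓝[>] 0) (𝓝 0) := by
      have h2 : Tendsto (fun ε : ℝ => C * ε ^ (2 * s) * M) (𝓝 0) (𝓝 (C * 0 ^ (2 * s) * M)) :=
        ((Real.continuousAt_rpow_const 0 (2 * s) (Or.inr (by positivity))).tendsto.const_mul
          C).mul_const M
      rw [Real.zero_rpow (by positivity), mul_zero, zero_mul] at h2
      exact h2.mono_left nhdsWithin_le_nhds
    have h3 := h1.eventually (gt_mem_nhds (show (0 : ℝ) < η / 2 by positivity))
    have h4 : ∀ᶠ ε : ℝ in 𝓝[>] 0, ε ≤ δ / 2 :=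
      nhdsWithin_le_nhds (Iic_mem_nhds (by positivity))
    obtain ⟨ε, ⟨h5, h6⟩, h7⟩ := ((h3.and h4).and self_mem_nhdsWithin).exists
    exact ⟨ε, h7, h6, h5⟩
  obtain ⟨b, hb, hbd⟩ := hbound ε hε hεδ
  have hT := (tendsto_integral_sq_ballIntegral hΩ ε hK hw).const_mul b
  rw [mul_zero] at hT
  obtain ⟨N, hN⟩ := eventually_atTop.1
    (hT.eventually (gt_mem_nhds (show (0 : ℝ) < η / 2 by positivity)))
  refine ⟨N, fun k hk => ?_⟩
  rw [Real.dist_eq, sub_zero, abs_of_nonneg (sq_nonneg _), norm_sq_eq_integral]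
  have h1 := hbd (e k) (he k) (hD k)
  have h2 := hN k hk.le
  have h3 : C * ε ^ (2 * s) * ∫ z, diffQuot A (e k) z ^ 2 ∂(pairD Ω δ) ≤ C * ε ^ (2 * s) * M := by
    gcongr
    exact hM k
  linarith

/-! ### The Hilbert space of states -/

theorem exists_subseq_tendsto_ae_of_tendsto_Lp {α : Type*} [MeasurableSpace α] {μ : Measure α}
    {f : ℕ → Lp ℝ 2 μ} {g : Lp ℝ 2 μ} (h : Tendsto f atTop (𝓝 g)) :
    ∃ φ : ℕ → ℕ, StrictMono φ ∧ ∀ᵐ x ∂μ, Tendsto (fun k => f (φ k) x) atTop (𝓝 (g x)) :=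
  (tendstoInMeasure_of_tendsto_Lp h).exists_seq_tendsto_ae

/-- The Hilbert space of pairs of a function on `Ω_δ` and a function on `Ω_δ × Ω_δ` in which the
graph of `u ↦ diffQuot A u` lives. -/
abbrev GraphSpace {n : ℕ} (Ω : Set (E n)) (δ : ℝ) : Type :=
  WithLp 2 (StateSpace Ω δ × Lp ℝ 2 (pairD Ω δ))

theorem isTestFunction_zero : IsTestFunction Ω (fun _ => 0) :=
  ⟨contDiff_const, HasCompactSupport.zero, by
    rw [show (fun _ : E n => (0 : ℝ)) = 0 from rfl, tsupport_zero]; exact Set.empty_subset _⟩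

theorem IsTestFunction.add {φ ψ : E n → ℝ} (hφ : IsTestFunction Ω φ) (hψ : IsTestFunction Ω ψ) :
    IsTestFunction Ω (fun x => φ x + ψ x) :=
  ⟨hφ.1.add hψ.1, hφ.2.1.add hψ.2.1,
    (tsupport_add φ ψ).trans (Set.union_subset hφ.2.2 hψ.2.2)⟩

theorem IsTestFunction.const_mul {φ : E n → ℝ} (hφ : IsTestFunction Ω φ) (c : ℝ) :
    IsTestFunction Ω (fun x => c * φ x) :=
  ⟨contDiff_const.mul hφ.1, hφ.2.1.mul_left,
    (closure_mono (Function.support_mul_subset_right _ φ)).trans hφ.2.2⟩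

/-- The graph of `φ ↦ diffQuot A φ` over the test functions. -/
noncomputable def testGraph {n : ℕ} (Ω : Set (E n)) (δ : ℝ) (A : ℝ → ℝ) :
    Submodule ℝ (GraphSpace Ω δ) where
  carrier := {x | ∃ φ, IsTestFunction Ω φ ∧ x.fst =ᵐ[volD Ω δ] φ ∧
    x.snd =ᵐ[pairD Ω δ] diffQuot A φ}
  add_mem' := by
    rintro x y ⟨φ, hφ, h1, h2⟩ ⟨ψ, hψ, h3, h4⟩
    refine ⟨_, hφ.add hψ, ?_, ?_⟩
    · rw [WithLp.add_fst]
      filter_upwards [Lp.coeFn_add x.fst y.fst, h1, h3] with z h5 h6 h7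
      rw [h5, Pi.add_apply, h6, h7]
    · rw [WithLp.add_snd]
      filter_upwards [Lp.coeFn_add x.snd y.snd, h2, h4] with z h5 h6 h7
      rw [h5, Pi.add_apply, h6, h7, diffQuot_add]
  zero_mem' := by
    refine ⟨_, isTestFunction_zero, ?_, ?_⟩
    · exact Lp.coeFn_zero _ _ _
    · filter_upwards [Lp.coeFn_zero ℝ 2 (pairD Ω δ)] with z hz
      rw [WithLp.zero_snd, hz]
      simp [diffQuot]
  smul_mem' := by
    rintro c x ⟨φ, hφ, h1, h2⟩
    refine ⟨_, hφ.const_mul c, ?_, ?_⟩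
    · rw [WithLp.smul_fst]
      filter_upwards [Lp.coeFn_smul c x.fst, h1] with z h5 h6
      rw [h5, Pi.smul_apply, h6, smul_eq_mul]
    · rw [WithLp.smul_snd]
      filter_upwards [Lp.coeFn_smul c x.snd, h2] with z h5 h6
      rw [h5, Pi.smul_apply, h6, smul_eq_mul, diffQuot_const_mul]

/-- The Hilbert space realization of `U_0^δ`: the closure of the graph of `φ ↦ diffQuot A φ` over
the test functions. The first component identifies it with `U_0^δ`. -/
noncomputable def stateGraph {n : ℕ} (Ω : Set (E n)) (δ : ℝ) (A : ℝ → ℝ) :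
    Submodule ℝ (GraphSpace Ω δ) :=
  (testGraph Ω δ A).topologicalClosure

instance : CompleteSpace (stateGraph Ω δ A) :=
  (Submodule.isClosed_topologicalClosure _).completeSpace_coe

theorem exists_seq_of_mem_stateGraph {x : GraphSpace Ω δ} (hx : x ∈ stateGraph Ω δ A) :
    ∃ t : ℕ → GraphSpace Ω δ, (∀ k, t k ∈ testGraph Ω δ A) ∧ Tendsto t atTop (𝓝 x) :=
  mem_closure_iff_seq_limit.1 hx

theorem snd_eq_diffQuot {x : GraphSpace Ω δ} (hx : x ∈ stateGraph Ω δ A) :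
    x.snd =ᵐ[pairD Ω δ] diffQuot A x.fst := by
  obtain ⟨t, ht, hlim⟩ := exists_seq_of_mem_stateGraph hx
  have h1 : Tendsto (fun k => (t k).fst) atTop (𝓝 x.fst) :=
    ((WithLp.prod_continuous_ofLp 2 _ _).fst.tendsto x).comp hlim
  have h2 : Tendsto (fun k => (t k).snd) atTop (𝓝 x.snd) :=
    ((WithLp.prod_continuous_ofLp 2 _ _).snd.tendsto x).comp hlim
  obtain ⟨φ, hφ, h3⟩ := exists_subseq_tendsto_ae_of_tendsto_Lp h1
  obtain ⟨ψ, hψ, h4⟩ := exists_subseq_tendsto_ae_of_tendsto_Lp (h2.comp hφ.tendsto_atTop)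
  have h5 : ∀ᵐ z ∂(pairD Ω δ), ∀ k, (t k).snd z = diffQuot A (t k).fst z := by
    refine ae_all_iff.2 fun k => ?_
    obtain ⟨f, -, hf1, hf2⟩ := ht k
    filter_upwards [hf2, diffQuot_congr (A := A) hf1] with z h6 h7
    rw [h6, h7]
  filter_upwards [h4, h5, ae_fst h3, ae_snd h3] with z h6 h7 h8 h9
  refine tendsto_nhds_unique h6 ?_
  simp only [Function.comp_apply, h7]
  exact ((h8.sub h9).const_mul _).comp hψ.tendsto_atTop

theorem fst_eq_zero_of_notMem {x : GraphSpace Ω δ} (hx : x ∈ stateGraph Ω δ A) :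
    ∀ᵐ y ∂(volD Ω δ), y ∉ Ω → x.fst y = 0 := by
  obtain ⟨t, ht, hlim⟩ := exists_seq_of_mem_stateGraph hx
  have h1 : Tendsto (fun k => (t k).fst) atTop (𝓝 x.fst) :=
    ((WithLp.prod_continuous_ofLp 2 _ _).fst.tendsto x).comp hlim
  obtain ⟨φ, hφ, h3⟩ := exists_subseq_tendsto_ae_of_tendsto_Lp h1
  have h5 : ∀ᵐ y ∂(volD Ω δ), ∀ k, y ∉ Ω → (t k).fst y = 0 := by
    refine ae_all_iff.2 fun k => ?_
    obtain ⟨f, hf, hf1, -⟩ := ht k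
    filter_upwards [hf1] with y h6 hy
    rw [h6]
    exact image_eq_zero_of_notMem_tsupport fun h => hy (hf.2.2 h)
  filter_upwards [h3, h5] with y h6 h7 hy
  refine tendsto_nhds_unique h6 ?_
  simp only [h7 _ hy]
  exact tendsto_const_nhds

theorem memLp_diffQuot_fst {x : GraphSpace Ω δ} (hx : x ∈ stateGraph Ω δ A) :
    MemLp (diffQuot A x.fst) 2 (pairD Ω δ) :=
  (memLp_congr_ae (snd_eq_diffQuot hx)).1 (Lp.memLp x.snd)

theorem integral_diffQuot_sq_fst {x : GraphSpace Ω δ} (hx : x ∈ stateGraph Ω δ A) :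
    ∫ z, diffQuot A x.fst z ^ 2 ∂(pairD Ω δ) = ‖x.snd‖ ^ 2 := by
  rw [norm_sq_eq_integral]
  refine integral_congr_ae ?_
  filter_upwards [snd_eq_diffQuot hx] with z hz
  rw [hz]

theorem IsKernel.form_fst (hA : IsKernel n δ A) (κ : E n → E n → ℝ) {x y : GraphSpace Ω δ}
    (hx : x ∈ stateGraph Ω δ A) (hy : y ∈ stateGraph Ω δ A) :
    form Ω δ A κ x.fst y.fst = ∫ z, κ z.1 z.2 * (x.snd z * y.snd z) ∂(pairD Ω δ) := by
  rw [hA.form_eq]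
  refine integral_congr_ae ?_
  filter_upwards [snd_eq_diffQuot hx, snd_eq_diffQuot hy] with z h1 h2
  rw [h1, h2]

theorem IsKernel.stateNorm_fst (hA : IsKernel n δ A) {x : GraphSpace Ω δ}
    (hx : x ∈ stateGraph Ω δ A) : stateNorm Ω δ A x.fst = ‖x.snd‖ := by
  rw [stateNorm, hA.form_unit_eq, integral_diffQuot_sq_fst hx, Real.sqrt_sq (norm_nonneg _)]

/-- The squared distance of a graph element to a test function is the quantity in the definition of
`U_0^δ`. -/
theorem IsKernel.norm_sub_sq_eq (hA : IsKernel n δ A) {x t : GraphSpace Ω δ} {φ : E n → ℝ}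
    (hx : x.snd =ᵐ[pairD Ω δ] diffQuot A x.fst) (h1 : t.fst =ᵐ[volD Ω δ] φ)
    (h2 : t.snd =ᵐ[pairD Ω δ] diffQuot A φ) :
    ‖x - t‖ ^ 2 = (∫ y, (x.fst y - φ y) ^ 2 ∂(volD Ω δ)) +
      form Ω δ A unitCond (fun y => x.fst y - φ y) (fun y => x.fst y - φ y) := by
  rw [WithLp.prod_norm_sq_eq_of_L2, norm_sq_eq_integral, norm_sq_eq_integral, hA.form_unit_eq,
    WithLp.sub_fst, WithLp.sub_snd]
  congr 1
  · refine integral_congr_ae ?_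
    filter_upwards [Lp.coeFn_sub x.fst t.fst, h1] with y h3 h4
    rw [h3, Pi.sub_apply, h4]
  · refine integral_congr_ae ?_
    filter_upwards [Lp.coeFn_sub x.snd t.snd, h2, hx] with y h3 h4 h5
    rw [h3, Pi.sub_apply, h4, h5, diffQuot_sub]

theorem IsKernel.fst_mem_energySpaceZero (hA : IsKernel n δ A) (hΩ : Bornology.IsBounded Ω)
    {x : GraphSpace Ω δ} (hx : x ∈ stateGraph Ω δ A) : x.fst ∈ energySpaceZero Ω δ A := by
  refine ⟨(hA.mem_energySpace_iff hΩ _).2 (memLp_diffQuot_fst hx), fun ε hε => ?_⟩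
  obtain ⟨t, ⟨φ, hφ, h1, h2⟩, hd⟩ :=
    Metric.mem_closure_iff.1 hx (√ε) (Real.sqrt_pos.2 hε)
  refine ⟨φ, hφ, ?_⟩
  rw [← hA.norm_sub_sq_eq (snd_eq_diffQuot hx) h1 h2, ← dist_eq_norm]
  exact (Real.lt_sqrt dist_nonneg).1 hd

theorem IsKernel.exists_of_mem_energySpaceZero (hA : IsKernel n δ A) (hΩ : Bornology.IsBounded Ω)
    {u : StateSpace Ω δ} (hu : u ∈ energySpaceZero Ω δ A) :
    ∃ x ∈ stateGraph Ω δ A, x.fst = u := by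
  obtain ⟨hu1, hu2⟩ := hu
  rw [hA.mem_energySpace_iff hΩ] at hu1
  refine ⟨WithLp.toLp 2 (u, hu1.toLp _), ?_, rfl⟩
  refine Metric.mem_closure_iff.2 fun ε hε => ?_
  obtain ⟨φ, hφ, hd⟩ := hu2 (ε ^ 2) (by positivity)
  have hφ1 : MemLp φ 2 (volD Ω δ) := hφ.memLp
  have hφ2 : MemLp (diffQuot A φ) 2 (pairD Ω δ) := hφ.memLp_diffQuot hA hΩ
  refine ⟨WithLp.toLp 2 (hφ1.toLp _, hφ2.toLp _), ⟨φ, hφ, hφ1.coeFn_toLp, hφ2.coeFn_toLp⟩, ?_⟩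
  rw [dist_eq_norm]
  refine lt_of_pow_lt_pow_left₀ 2 hε.le ?_
  rw [hA.norm_sub_sq_eq (φ := φ) hu1.coeFn_toLp hφ1.coeFn_toLp hφ2.coeFn_toLp]
  exact hd

/-- The nonlocal Poincaré inequality on the Hilbert space of states. -/
theorem IsKernel.exists_norm_fst_le (hA : IsKernel n δ A) (hn : 2 ≤ n) (hΩo : IsOpen Ω)
    (hΩ : Bornology.IsBounded Ω) (hδ : 0 < δ) :
    ∃ C : ℝ, 0 < C ∧ ∀ x ∈ stateGraph Ω δ A, ‖x.fst‖ ≤ C * ‖x.snd‖ := by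
  obtain ⟨C, hC, hP⟩ := hA.exists_poincare hn hΩo hΩ hδ
  refine ⟨√C, Real.sqrt_pos.2 hC, fun x hx => ?_⟩
  have h := hP x.fst (fst_eq_zero_of_notMem hx) (memLp_diffQuot_fst hx)
  rw [integral_diffQuot_sq_fst hx, ← norm_sq_eq_integral] at h
  refine le_of_sq_le_sq ?_ (by positivity)
  rwa [mul_pow, Real.sq_sqrt hC.le]

/-- The load functional is the inner product with the zero extension of `f`. -/
theorem exists_load_eq_inner (hΩo : IsOpen Ω) (hδ : 0 < δ) (f : Lp ℝ 2 (volume.restrict Ω)) :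
    ∃ g : StateSpace Ω δ, ∀ v : StateSpace Ω δ, load Ω f v = ⟪g, v⟫ := by
  have hm : MemLp (Ω.indicator f) 2 (volume : Measure (E n)) :=
    (memLp_indicator_iff_restrict hΩo.measurableSet).2 (Lp.memLp f)
  have hg : MemLp (Ω.indicator f) 2 (volD Ω δ) := hm.restrict _
  refine ⟨hg.toLp _, fun v => ?_⟩
  have h1 : volume.restrict Ω = (volD Ω δ).restrict Ω := by
    rw [Measure.restrict_restrict hΩo.measurableSet,
      Set.inter_eq_self_of_subset_left (Metric.self_subset_thickening hδ Ω)]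
  rw [inner_eq_integral, load]
  refine (congrArg (fun m : Measure (E n) => ∫ x, (f : E n → ℝ) x * v x ∂m) h1).trans ?_
  rw [← integral_indicator hΩo.measurableSet]
  refine integral_congr_ae ?_
  filter_upwards [hg.coeFn_toLp] with x hx
  rw [hx]
  by_cases h : x ∈ Ω <;> simp [h]

/-! ### Weak* convergence of designs and conductivities -/

/-- For uniformly bounded functions, convergence of the integrals against bounded continuous
functions extends to all integrable ones. -/
theorem tendsto_integral_mul_of_bounded {α : Type*} [TopologicalSpace α] [NormalSpace α]
    [MeasurableSpace α] [BorelSpace α] {μ : Measure α} [IsFiniteMeasure μ] [μ.WeaklyRegular]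
    {g : ℕ → α → ℝ} {g' : α → ℝ} {C : ℝ} (hm : ∀ k, AEStronglyMeasurable (g k) μ)
    (hm' : AEStronglyMeasurable g' μ) (hC : ∀ k, ∀ᵐ x ∂μ, |g k x| ≤ C)
    (hC' : ∀ᵐ x ∂μ, |g' x| ≤ C)
    (h : ∀ v : BoundedContinuousFunction α ℝ,
      Tendsto (fun k => ∫ x, g k x * v x ∂μ) atTop (𝓝 (∫ x, g' x * v x ∂μ)))
    {ψ : α → ℝ} (hψ : Integrable ψ μ) :
    Tendsto (fun k => ∫ x, g k x * ψ x ∂μ) atTop (𝓝 (∫ x, g' x * ψ x ∂μ)) := by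
  rw [Metric.tendsto_atTop]
  intro ε hε
  obtain ⟨v, hv, hvi⟩ := hψ.exists_boundedContinuous_integral_sub_le
    (show 0 < ε / (4 * (|C| + 1)) by positivity)
  have hest : ∀ f : α → ℝ, AEStronglyMeasurable f μ → (∀ᵐ x ∂μ, |f x| ≤ C) →
      |(∫ x, f x * ψ x ∂μ) - ∫ x, f x * v x ∂μ| ≤ ε / 4 := by
    intro f hf hfC
    have hfC' : ∀ᵐ x ∂μ, ‖f x‖ ≤ C := by simpa using hfC
    rw [← integral_sub (hψ.bdd_mul hf hfC') (hvi.bdd_mul hf hfC')]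
    calc |∫ x, (f x * ψ x - f x * v x) ∂μ| ≤ ∫ x, |C| * ‖ψ x - v x‖ ∂μ := by
          rw [← Real.norm_eq_abs]
          refine norm_integral_le_of_norm_le ((hψ.sub hvi).norm.const_mul _) ?_
          filter_upwards [hfC] with x hx
          rw [← mul_sub, norm_mul]
          gcongr
          exact hx.trans (le_abs_self C)
      _ ≤ |C| * (ε / (4 * (|C| + 1))) := by
          rw [integral_const_mul]; gcongr
      _ ≤ (|C| + 1) * (ε / (4 * (|C| + 1))) := by gcongr; linarith
      _ = ε / 4 := by field_simp
  obtain ⟨N, hN⟩ := Metric.tendsto_atTop.1 (h v) (ε / 4) (by positivity)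
  refine ⟨N, fun k hk => ?_⟩
  have h1 := abs_le.1 (hest (g k) (hm k) (hC k))
  have h2 := abs_le.1 (hest g' hm' hC')
  have h3 := abs_lt.1 (hN k hk)
  rw [Real.dist_eq, abs_lt]
  constructor <;> linarith [h1.1, h1.2, h2.1, h2.2, h3.1, h3.2]

theorem admissible_abs_le (hρlo : 0 < ρlo) {ρ : DesignSpace Ω δ}
    (hρ : ρ ∈ admissible Ω δ ρlo ρhi γ) : ∀ᵐ x ∂(volD Ω δ), |ρ x| ≤ ρhi := by
  filter_upwards [hρ.1] with x hx
  rw [abs_of_nonneg (by linarith [hx.1])]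
  exact hx.2

/-- Weak* sequential compactness of the set of admissible designs. The weak limit is found in
`L²(Ω_δ)`; the pointwise bounds and the volume constraint pass to it by testing with indicators. -/
theorem exists_weakStar_subseq (hΩo : IsOpen Ω) (hΩ : Bornology.IsBounded Ω) (hδ : 0 < δ)
    (hρlo : 0 < ρlo) {ρ : ℕ → DesignSpace Ω δ}
    (hρ : ∀ k, ρ k ∈ admissible Ω δ ρlo ρhi γ) :
    ∃ ρ' ∈ admissible Ω δ ρlo ρhi γ, ∃ φ : ℕ → ℕ, StrictMono φ ∧
      WeakStarTendsto (fun k => ρ (φ k)) ρ' := by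
  have := isFiniteMeasure_volD (δ := δ) hΩ
  have : Fact ((2 : ℝ≥0∞) ≠ ⊤) := ⟨by simp⟩
  have hr : ∀ k, MemLp (ρ k) 2 (volD Ω δ) := fun k => (Lp.memLp (ρ k)).mono_exponent le_top
  have hbd : ∀ k, ‖(hr k).toLp _‖ ≤ √(ρhi ^ 2 * (volD Ω δ).real Set.univ) := by
    intro k
    refine Real.le_sqrt_of_sq_le ?_
    rw [norm_toLp_sq]
    have h1 : ∫ x, ρ k x ^ 2 ∂(volD Ω δ) ≤ ∫ _x, ρhi ^ 2 ∂(volD Ω δ) := by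
      refine integral_mono_ae (hr k).integrable_sq (integrable_const _) ?_
      filter_upwards [admissible_abs_le hρlo (hρ k)] with x hx
      rw [← sq_abs]
      gcongr
    rwa [integral_const, smul_eq_mul, mul_comm] at h1
  obtain ⟨r, φ, hφ, hweak⟩ := exists_weakly_convergent_subseq hbd
  have htest : ∀ v : E n → ℝ, MemLp v 2 (volD Ω δ) →
      Tendsto (fun k => ∫ x, ρ (φ k) x * v x ∂(volD Ω δ)) atTop
        (𝓝 (∫ x, r x * v x ∂(volD Ω δ))) := by
    intro v hv
    have h1 := hweak (hv.toLp v)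
    have h2 : ∫ x, r x * v x ∂(volD Ω δ) = ⟪r, hv.toLp v⟫ := by
      rw [inner_eq_integral]
      refine integral_congr_ae ?_
      filter_upwards [hv.coeFn_toLp] with x hx
      rw [hx]
    rw [h2]
    simpa only [integral_mul_eq_inner (hr _) hv] using h1
  have hset : ∀ S : Set (E n), MeasurableSet S →
      Tendsto (fun k => ∫ x in S, ρ (φ k) x ∂(volD Ω δ)) atTop
        (𝓝 (∫ x in S, r x ∂(volD Ω δ))) := by
    intro S hS
    have h1 := htest (S.indicator fun _ => 1) (memLp_indicator_const 2 hS 1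
      (Or.inr (measure_ne_top _ _)))
    have h2 : ∀ f : E n → ℝ, ∫ x, f x * S.indicator (fun _ => 1) x ∂(volD Ω δ) =
        ∫ x in S, f x ∂(volD Ω δ) := by
      intro f
      rw [← integral_indicator hS]
      refine integral_congr_ae (ae_of_all _ fun x => ?_)
      by_cases h : x ∈ S <;> simp [h]
    simpa only [h2] using h1
  have hri : Integrable r (volD Ω δ) := (Lp.memLp r).integrable one_le_two
  have hρi : ∀ k, Integrable (ρ k) (volD Ω δ) := fun k => (hr k).integrable one_le_two
  have hlo : (fun _ => ρlo) ≤ᵐ[volD Ω δ] r := by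
    refine ae_le_of_forall_setIntegral_le (integrable_const _) hri fun S hS _ => ?_
    refine ge_of_tendsto' (hset S hS) fun k => ?_
    refine setIntegral_mono_ae (integrable_const _).integrableOn (hρi _).integrableOn ?_
    filter_upwards [(hρ (φ k)).1] with x hx using hx.1
  have hhi : r ≤ᵐ[volD Ω δ] fun _ => ρhi := by
    refine ae_le_of_forall_setIntegral_le hri (integrable_const _) fun S hS _ => ?_
    refine le_of_tendsto' (hset S hS) fun k => ?_
    refine setIntegral_mono_ae (hρi _).integrableOn (integrable_const _).integrableOn ?_
    filter_upwards [(hρ (φ k)).1] with x hx using hx.2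
  have hrtop : MemLp r ∞ (volD Ω δ) := by
    refine memLp_top_of_bound (Lp.aestronglyMeasurable r) ρhi ?_
    filter_upwards [hlo, hhi] with x h1 h2
    rw [Real.norm_of_nonneg (hρlo.le.trans h1)]
    exact h2
  have hcoe := hrtop.coeFn_toLp
  have hΩr : ∀ f : E n → ℝ, ∫ x in Ω, f x = ∫ x in Ω, f x ∂(volD Ω δ) := by
    intro f
    rw [Measure.restrict_restrict hΩo.measurableSet,
      Set.inter_eq_self_of_subset_left (Metric.self_subset_thickening hδ Ω)]
  have hadm : hrtop.toLp r ∈ admissible Ω δ ρlo ρhi γ := by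
    constructor
    · filter_upwards [hcoe, hlo, hhi] with x h1 h2 h3
      rw [h1]
      exact ⟨h2, h3⟩
    · rw [hΩr, integral_congr_ae (ae_restrict_of_ae hcoe)]
      refine le_of_tendsto' (hset Ω hΩo.measurableSet) fun k => ?_
      rw [← hΩr]
      exact (hρ (φ k)).2
  refine ⟨_, hadm, φ, hφ, fun ψ hψ => ?_⟩
  refine tendsto_integral_mul_of_bounded (fun k => Lp.aestronglyMeasurable _)
    (Lp.aestronglyMeasurable _) (fun k => admissible_abs_le hρlo (hρ _))
    (admissible_abs_le hρlo hadm) (fun v => ?_) hψ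
  have hv : MemLp v 2 (volD Ω δ) := MemLp.of_bound v.continuous.aestronglyMeasurable ‖v‖
    (ae_of_all _ fun x => v.norm_coe_le_norm x)
  have h1 : ∫ x, hrtop.toLp r x * v x ∂(volD Ω δ) = ∫ x, r x * v x ∂(volD Ω δ) := by
    refine integral_congr_ae ?_
    filter_upwards [hcoe] with x hx
    rw [hx]
  rw [h1]
  exact htest v hv

/-- The conductivities `ρ_k(x) ρ_k(x')` converge weakly* in `L^∞(Ω_δ × Ω_δ)` when the designs
`ρ_k` do. For an exponent `p ≠ 2` the factors would be `ρ_k ^ (p / 2)`, whose weak* limit need not be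
`ρ' ^ (p / 2)`. -/
theorem tendsto_integral_mul_conductivity (hΩ : Bornology.IsBounded Ω) (hρlo : 0 < ρlo)
    {ρ : ℕ → DesignSpace Ω δ} {ρ' : DesignSpace Ω δ}
    (hρ : ∀ k, ρ k ∈ admissible Ω δ ρlo ρhi γ) (hρ' : ρ' ∈ admissible Ω δ ρlo ρhi γ)
    (hlim : WeakStarTendsto ρ ρ') {G : E n × E n → ℝ} (hG : Integrable G (pairD Ω δ)) :
    Tendsto (fun k => ∫ z, ρ k z.1 * ρ k z.2 * G z ∂(pairD Ω δ)) atTop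
      (𝓝 (∫ z, ρ' z.1 * ρ' z.2 * G z ∂(pairD Ω δ))) := by
  have := isFiniteMeasure_volD (δ := δ) hΩ
  have hG' : Integrable G ((volD Ω δ).prod (volD Ω δ)) := hG
  -- integrating out the second variable turns `G` into a strongly convergent sequence
  set g : DesignSpace Ω δ → E n → ℝ := fun σ x => ∫ y, σ y * G (x, y) ∂(volD Ω δ) with hg
  have hint : ∀ σ ∈ admissible Ω δ ρlo ρhi γ,
      Integrable (fun z : E n × E n => σ z.2 * G z) ((volD Ω δ).prod (volD Ω δ)) := by
    intro σ hσ
    exact hG'.bdd_mul (Lp.aestronglyMeasurable σ).comp_snd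
      (by simpa using ae_snd (admissible_abs_le hρlo hσ))
  have hgi : ∀ σ ∈ admissible Ω δ ρlo ρhi γ, Integrable (g σ) (volD Ω δ) := fun σ hσ =>
    (hint σ hσ).integral_prod_left
  have hfub : ∀ σ ∈ admissible Ω δ ρlo ρhi γ,
      ∫ z, σ z.1 * σ z.2 * G z ∂(pairD Ω δ) = ∫ x, σ x * g σ x ∂(volD Ω δ) := by
    intro σ hσ
    have h1 : Integrable (fun z : E n × E n => σ z.1 * σ z.2 * G z)
        ((volD Ω δ).prod (volD Ω δ)) := by
      have h2 : Integrable (fun z : E n × E n => σ z.1 * (σ z.2 * G z))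
          ((volD Ω δ).prod (volD Ω δ)) :=
        (hint σ hσ).bdd_mul (Lp.aestronglyMeasurable σ).comp_fst
          (by simpa using ae_fst (admissible_abs_le hρlo hσ))
      simpa only [mul_assoc] using h2
    rw [integral_prod _ h1]
    refine integral_congr_ae (ae_of_all _ fun x => ?_)
    simp only [hg, mul_assoc, integral_const_mul]
  have hgbd : ∀ σ ∈ admissible Ω δ ρlo ρhi γ, ∀ᵐ x ∂(volD Ω δ),
      ‖g σ x‖ ≤ ρhi * ∫ y, ‖G (x, y)‖ ∂(volD Ω δ) := by
    intro σ hσ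
    filter_upwards [hG'.prod_right_ae] with x hx
    rw [← integral_const_mul]
    refine norm_integral_le_of_norm_le (hx.norm.const_mul _) ?_
    filter_upwards [admissible_abs_le hρlo hσ] with y hy
    rw [norm_mul]
    gcongr
    exact hy
  have h1 : Tendsto (fun k => ∫ x, ρ k x * (g (ρ k) x - g ρ' x) ∂(volD Ω δ)) atTop
      (𝓝 (∫ _x, (0 : ℝ) ∂(volD Ω δ))) := by
    refine tendsto_integral_of_dominated_convergence
      (fun x => ρhi * (ρhi * ∫ y, ‖G (x, y)‖ ∂(volD Ω δ) + ρhi * ∫ y, ‖G (x, y)‖ ∂(volD Ω δ)))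
      (fun k => (Lp.aestronglyMeasurable _).mul
        ((hgi _ (hρ k)).aestronglyMeasurable.sub (hgi _ hρ').aestronglyMeasurable)) ?_ ?_ ?_
    · have h := hG'.norm.integral_prod_left.const_mul ρhi
      exact (h.add h).const_mul ρhi
    · intro k
      filter_upwards [admissible_abs_le hρlo (hρ k), hgbd _ (hρ k), hgbd _ hρ'] with x h2 h3 h4
      rw [norm_mul]
      have h5 := norm_sub_le (g (ρ k) x) (g ρ' x)
      exact mul_le_mul h2 (by linarith) (norm_nonneg _) ((abs_nonneg _).trans h2)
    · filter_upwards [hG'.prod_right_ae,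
        ae_all_iff.2 fun k => admissible_abs_le hρlo (hρ k)] with x hx hb
      have h2 : Tendsto (fun k => g (ρ k) x - g ρ' x) atTop (𝓝 0) := by
        exact tendsto_sub_nhds_zero_iff.2 (hlim _ hx)
      refine squeeze_zero_norm (fun k => ?_) (by simpa using h2.norm.const_mul ρhi)
      rw [norm_mul]
      exact mul_le_mul_of_nonneg_right (hb k) (norm_nonneg _)
  have h2 := h1.add (hlim _ (hgi _ hρ'))
  rw [integral_zero, zero_add] at h2
  rw [hfub _ hρ']
  refine h2.congr fun k => ?_
  have hb : ∀ᵐ x ∂(volD Ω δ), ‖ρ k x‖ ≤ ρhi := by simpa using admissible_abs_le hρlo (hρ k)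
  have h3 := (hgi _ (hρ k)).bdd_mul (Lp.aestronglyMeasurable (ρ k)) hb
  have h4 := (hgi _ hρ').bdd_mul (Lp.aestronglyMeasurable (ρ k)) hb
  rw [hfub _ (hρ k)]
  simp only [mul_sub]
  rw [integral_sub h3 h4]
  ring

/-! ### Energy pairings with `L²`-null sequences -/

/-- The difference between `|V|` and its damped version `|V| / (1 + η * weight A * |V|)`. The damped
version times `weight A` is at most `1 / η`, which compensates the singularity of the weight; the
difference tends to zero as `η → 0`. -/
noncomputable def dampingRemainder {n : ℕ} (A : ℝ → ℝ) (V : E n × E n → ℝ) (η : ℝ)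
    (z : E n × E n) : ℝ :=
  |V z| * (η * (weight A z * |V z|) / (1 + η * (weight A z * |V z|)))

theorem abs_dampingRemainder_le (V : E n × E n → ℝ) {η : ℝ} (hη : 0 ≤ η) (z : E n × E n) :
    |dampingRemainder A V η z| ≤ |V z| := by
  have hw := weight_nonneg (A := A) z
  have ht : 0 ≤ η * (weight A z * |V z|) := by positivity
  have hq : 0 ≤ η * (weight A z * |V z|) / (1 + η * (weight A z * |V z|)) := by positivity
  rw [dampingRemainder, abs_mul, abs_abs, abs_of_nonneg hq]
  refine mul_le_of_le_one_right (abs_nonneg _) ?_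
  rw [div_le_one (by positivity)]
  linarith

theorem abs_mul_abs_diffQuot_le (V : E n × E n → ℝ) {η : ℝ} (hη : 0 < η) (e : E n → ℝ)
    (z : E n × E n) :
    |V z| * |diffQuot A e z| ≤
      η⁻¹ * (|e z.1| + |e z.2|) + dampingRemainder A V η z * |diffQuot A e z| := by
  have hw := weight_nonneg (A := A) z
  set t := weight A z * |V z| with ht
  have ht0 : 0 ≤ t := by positivity
  have h1 : |V z| * |diffQuot A e z| - dampingRemainder A V η z * |diffQuot A e z| =
      t / (1 + η * t) * |e z.1 - e z.2| := by
    have hne : 1 + η * t ≠ 0 := by positivity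
    rw [dampingRemainder, ← ht, diffQuot, abs_mul, abs_of_nonneg hw]
    field_simp
    rw [ht]
    ring
  have h2 : t / (1 + η * t) ≤ η⁻¹ := by
    rw [div_le_iff₀ (by positivity), mul_add, inv_mul_cancel_left₀ hη.ne']
    linarith [inv_pos.2 hη]
  have h3 : |e z.1 - e z.2| ≤ |e z.1| + |e z.2| := abs_sub _ _
  have h4 := mul_le_mul h2 h3 (abs_nonneg _) (inv_pos.2 hη).le
  linarith

theorem IsKernel.aestronglyMeasurable_dampingRemainder (hA : IsKernel n δ A)
    (hΩ : Bornology.IsBounded Ω) {V : E n × E n → ℝ} (hV : MemLp V 2 (pairD Ω δ)) (η : ℝ) :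
    AEStronglyMeasurable (dampingRemainder A V η) (pairD Ω δ) := by
  have hVa : AEMeasurable (fun z => |V z|) (pairD Ω δ) :=
    hV.abs.aestronglyMeasurable.aemeasurable
  have hw : AEMeasurable (fun z => η * (weight A z * |V z|)) (pairD Ω δ) :=
    ((hA.aestronglyMeasurable_weight hΩ).aemeasurable.mul hVa).const_mul η
  exact (hVa.mul (hw.div (hw.const_add 1))).aestronglyMeasurable

theorem IsKernel.memLp_dampingRemainder (hA : IsKernel n δ A)
    (hΩ : Bornology.IsBounded Ω) {V : E n × E n → ℝ} (hV : MemLp V 2 (pairD Ω δ)) {η : ℝ}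
    (hη : 0 ≤ η) : MemLp (dampingRemainder A V η) 2 (pairD Ω δ) :=
  hV.mono (hA.aestronglyMeasurable_dampingRemainder hΩ hV η)
    (ae_of_all _ fun z => abs_dampingRemainder_le V hη z)

theorem IsKernel.tendsto_integral_dampingRemainder_sq (hA : IsKernel n δ A)
    (hΩ : Bornology.IsBounded Ω) {V : E n × E n → ℝ} (hV : MemLp V 2 (pairD Ω δ)) :
    Tendsto (fun j : ℕ => ∫ z, dampingRemainder A V (1 / ((j : ℝ) + 1)) z ^ 2 ∂(pairD Ω δ))
      atTop (𝓝 0) := by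
  rw [← integral_zero (E n × E n) ℝ (μ := pairD Ω δ)]
  refine tendsto_integral_of_dominated_convergence (fun z => V z ^ 2)
    (fun j => (hA.aestronglyMeasurable_dampingRemainder hΩ hV _).pow 2) hV.integrable_sq
    (fun j => ae_of_all _ fun z => ?_) (ae_of_all _ fun z => ?_)
  · rw [Real.norm_of_nonneg (sq_nonneg _)]
    exact sq_le_sq.2 (abs_dampingRemainder_le V (by positivity) z)
  · have h1 : Tendsto (fun j : ℕ => 1 / ((j : ℝ) + 1) * (weight A z * |V z|)) atTop (𝓝 0) := by
      simpa using tendsto_one_div_add_atTop_nhds_zero_nat.mul_const (weight A z * |V z|)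
    have h2 := ((h1.div (h1.const_add 1) (by norm_num)).const_mul |V z|).pow 2
    simpa [dampingRemainder] using h2

theorem integral_abs_add_abs_le (hΩ : Bornology.IsBounded Ω) (e : StateSpace Ω δ) :
    Integrable (fun z : E n × E n => |e z.1| + |e z.2|) (pairD Ω δ) ∧
    ∫ z, (|e z.1| + |e z.2|) ∂(pairD Ω δ) ≤
      2 * (volD Ω δ).real Set.univ * √((volD Ω δ).real Set.univ) * ‖e‖ := by
  have := isFiniteMeasure_volD (δ := δ) hΩ
  have hi : Integrable (fun x => |e x|) (volD Ω δ) :=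
    ((Lp.memLp e).integrable one_le_two).abs
  have h1 : Integrable (fun z : E n × E n => |e z.1|) (pairD Ω δ) := hi.comp_fst _
  have h2 : Integrable (fun z : E n × E n => |e z.2|) (pairD Ω δ) := hi.comp_snd _
  refine ⟨h1.add h2, ?_⟩
  have h3 : ∫ x, |e x| ∂(volD Ω δ) ≤ √((volD Ω δ).real Set.univ) * ‖e‖ := by
    have h4 := sq_integral_le (Lp.memLp e).abs
    simp only [Pi.abs_apply, sq_abs] at h4
    rw [← norm_sq_eq_integral] at h4
    refine le_of_sq_le_sq ?_ (by positivity)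
    rwa [mul_pow, Real.sq_sqrt measureReal_nonneg]
  rw [integral_add h1 h2, integral_fun_fst (fun x => |e x|), integral_fun_snd (fun x => |e x|),
    smul_eq_mul]
  nlinarith [mul_le_mul_of_nonneg_left h3 (measureReal_nonneg (μ := volD Ω δ) (s := Set.univ))]

/-- If `e_k → 0` in `L²(Ω_δ)` with bounded energies, then the products of `|diffQuot A e_k|` with a
fixed square integrable function tend to zero in `L¹`. Since the conductivities are bounded, no
control on their oscillation is needed. -/
theorem IsKernel.tendsto_integral_abs_mul_abs_diffQuot (hA : IsKernel n δ A)
    (hΩ : Bornology.IsBounded Ω) {V : E n × E n → ℝ} (hV : MemLp V 2 (pairD Ω δ))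
    {e : ℕ → StateSpace Ω δ} {M : ℝ} (hD : ∀ k, MemLp (diffQuot A (e k)) 2 (pairD Ω δ))
    (hM : ∀ k, ∫ z, diffQuot A (e k) z ^ 2 ∂(pairD Ω δ) ≤ M)
    (he : Tendsto (fun k => ‖e k‖) atTop (𝓝 0)) :
    Tendsto (fun k => ∫ z, |V z| * |diffQuot A (e k) z| ∂(pairD Ω δ)) atTop (𝓝 0) := by
  rw [Metric.tendsto_atTop']
  intro ε hε
  have h1 := (hA.tendsto_integral_dampingRemainder_sq hΩ hV).sqrt.mul_const √M
  rw [Real.sqrt_zero, zero_mul] at h1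
  obtain ⟨j, hj⟩ := (h1.eventually (gt_mem_nhds (show (0 : ℝ) < ε / 2 by positivity))).exists
  set η : ℝ := 1 / ((j : ℝ) + 1) with hηdef
  have hη : 0 < η := by positivity
  set c := 2 * (volD Ω δ).real Set.univ * √((volD Ω δ).real Set.univ)
  have h2 : Tendsto (fun k => η⁻¹ * (c * ‖e k‖)) atTop (𝓝 0) := by
    simpa using (he.const_mul c).const_mul η⁻¹
  obtain ⟨N, hN⟩ := eventually_atTop.1
    (h2.eventually (gt_mem_nhds (show (0 : ℝ) < ε / 2 by positivity)))
  refine ⟨N, fun k hk => ?_⟩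
  have h3 := hN k hk.le
  obtain ⟨hi, hle⟩ := integral_abs_add_abs_le hΩ (e k)
  have hR := hA.memLp_dampingRemainder hΩ hV hη.le
  have hRi : Integrable (fun z => dampingRemainder A V η z * |diffQuot A (e k) z|) (pairD Ω δ) :=
    hR.integrable_mul (hD k).abs
  have h4 : ∫ z, |V z| * |diffQuot A (e k) z| ∂(pairD Ω δ) ≤
      η⁻¹ * ∫ z, (|e k z.1| + |e k z.2|) ∂(pairD Ω δ) +
        ∫ z, dampingRemainder A V η z * |diffQuot A (e k) z| ∂(pairD Ω δ) := by
    rw [← integral_const_mul, ← integral_add (hi.const_mul _) hRi]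
    exact integral_mono (hV.abs.integrable_mul (hD k).abs) ((hi.const_mul _).add hRi)
      fun z => abs_mul_abs_diffQuot_le V hη (e k) z
  have h5 := (le_abs_self _).trans (abs_integral_mul_le hR (hD k).abs)
  simp only [Pi.abs_apply, sq_abs] at h5
  have h6 : √(∫ z, dampingRemainder A V η z ^ 2 ∂(pairD Ω δ)) *
      √(∫ z, diffQuot A (e k) z ^ 2 ∂(pairD Ω δ)) ≤
      √(∫ z, dampingRemainder A V η z ^ 2 ∂(pairD Ω δ)) * √M := by
    gcongr
    exact hM k
  have h7 : η⁻¹ * ∫ z, (|e k z.1| + |e k z.2|) ∂(pairD Ω δ) ≤ η⁻¹ * (c * ‖e k‖) := by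
    gcongr
  rw [Real.dist_eq, sub_zero, abs_of_nonneg (integral_nonneg fun z => by positivity)]
  linarith

/-! ### The state equation -/

theorem integral_abs_mul_abs_le_norm {α : Type*} [MeasurableSpace α] {μ : Measure α}
    (f g : Lp ℝ 2 μ) : ∫ x, |f x| * |g x| ∂μ ≤ ‖f‖ * ‖g‖ := by
  have h := (le_abs_self _).trans (abs_integral_mul_le (Lp.memLp f).abs (Lp.memLp g).abs)
  simp only [Pi.abs_apply, sq_abs] at h
  rwa [← norm_sq_eq_integral, ← norm_sq_eq_integral, Real.sqrt_sq (norm_nonneg _),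
    Real.sqrt_sq (norm_nonneg _)] at h

/-- A bounded conductivity defines a bounded bilinear form on `L²`. -/
theorem exists_bilin_of_bound {α : Type*} [MeasurableSpace α] {μ : Measure α} {κ : α → ℝ} {C : ℝ}
    (hC0 : 0 ≤ C) (hκ : AEStronglyMeasurable κ μ) (hC : ∀ᵐ x ∂μ, |κ x| ≤ C) :
    ∃ B : Lp ℝ 2 μ →L[ℝ] Lp ℝ 2 μ →L[ℝ] ℝ, ∀ f g, B f g = ∫ x, κ x * (f x * g x) ∂μ := by
  have hi : ∀ f g : Lp ℝ 2 μ, Integrable (fun x => κ x * (f x * g x)) μ := fun f g =>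
    integrable_mul_mul_of_bound hκ hC (Lp.memLp f) (Lp.memLp g)
  have hcomm : ∀ f g : Lp ℝ 2 μ,
      ∫ x, κ x * (f x * g x) ∂μ = ∫ x, κ x * (g x * f x) ∂μ := fun f g => by
    simp only [mul_comm]
  have hadd : ∀ f₁ f₂ g : Lp ℝ 2 μ, ∫ x, κ x * ((f₁ + f₂ : Lp ℝ 2 μ) x * g x) ∂μ =
      (∫ x, κ x * (f₁ x * g x) ∂μ) + ∫ x, κ x * (f₂ x * g x) ∂μ := by
    intro f₁ f₂ g
    rw [← integral_add (hi _ _) (hi _ _)]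
    refine integral_congr_ae ?_
    filter_upwards [Lp.coeFn_add f₁ f₂] with x hx
    rw [hx, Pi.add_apply]
    ring
  have hsmul : ∀ (c : ℝ) (f g : Lp ℝ 2 μ), ∫ x, κ x * ((c • f : Lp ℝ 2 μ) x * g x) ∂μ =
      c • ∫ x, κ x * (f x * g x) ∂μ := by
    intro c f g
    rw [smul_eq_mul, ← integral_const_mul]
    refine integral_congr_ae ?_
    filter_upwards [Lp.coeFn_smul c f] with x hx
    rw [hx, Pi.smul_apply, smul_eq_mul]
    ring
  refine ⟨LinearMap.mkContinuous₂ (LinearMap.mk₂ ℝ (fun f g => ∫ x, κ x * (f x * g x) ∂μ)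
    hadd hsmul (fun f g₁ g₂ => ?_) fun c f g => ?_) C fun f g => ?_, fun f g => rfl⟩
  · rw [hcomm f, hadd, hcomm g₁, hcomm g₂]
  · rw [hcomm f, hsmul, hcomm g]
  · rw [LinearMap.mk₂_apply, Real.norm_eq_abs, mul_assoc]
    refine (abs_integral_mul_mul_le hC (Lp.memLp f) (Lp.memLp g)).trans ?_
    gcongr
    exact integral_abs_mul_abs_le_norm f g

/-- For an admissible design `ρ` the conductivity `ρ(x) ρ(x')` gives a bounded bilinear form on
`L²(Ω_δ × Ω_δ)`, bounded below by `ρlo ^ 2`. -/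
theorem exists_conductivity_bilin (hΩ : Bornology.IsBounded Ω) (hρlo : 0 < ρlo)
    {ρ : DesignSpace Ω δ} (hρ : ρ ∈ admissible Ω δ ρlo ρhi γ) :
    ∃ B : Lp ℝ 2 (pairD Ω δ) →L[ℝ] Lp ℝ 2 (pairD Ω δ) →L[ℝ] ℝ,
      (∀ f g, B f g = ∫ z, ρ z.1 * ρ z.2 * (f z * g z) ∂(pairD Ω δ)) ∧
      (∀ f, ρlo ^ 2 * ‖f‖ ^ 2 ≤ B f f) ∧
      ∀ f g, |B f g| ≤ ρhi ^ 2 * ∫ z, |f z| * |g z| ∂(pairD Ω δ) := by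
  have := isFiniteMeasure_volD (δ := δ) hΩ
  have hm : AEStronglyMeasurable (fun z : E n × E n => ρ z.1 * ρ z.2) (pairD Ω δ) :=
    (Lp.aestronglyMeasurable ρ).comp_fst.mul (Lp.aestronglyMeasurable ρ).comp_snd
  have habs := admissible_abs_le hρlo hρ
  have hbd : ∀ᵐ z ∂(pairD Ω δ), |ρ z.1 * ρ z.2| ≤ ρhi ^ 2 := by
    filter_upwards [ae_fst habs, ae_snd habs] with z h1 h2
    rw [abs_mul, sq]
    exact mul_le_mul h1 h2 (abs_nonneg _) ((abs_nonneg _).trans h1)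
  obtain ⟨B, hB⟩ := exists_bilin_of_bound (sq_nonneg ρhi) hm hbd
  refine ⟨B, hB, fun f => ?_, fun f g => ?_⟩
  · rw [hB, norm_sq_eq_integral, ← integral_const_mul]
    refine integral_mono_ae ((Lp.memLp f).integrable_sq.const_mul _)
      (integrable_mul_mul_of_bound hm hbd (Lp.memLp f) (Lp.memLp f)) ?_
    filter_upwards [ae_fst hρ.1, ae_snd hρ.1] with z h1 h2
    have h3 : ρlo ^ 2 ≤ ρ z.1 * ρ z.2 := by
      rw [sq]
      exact mul_le_mul h1.1 h2.1 hρlo.le (hρlo.le.trans h1.1)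
    rw [← sq]
    exact mul_le_mul_of_nonneg_right h3 (sq_nonneg _)
  · rw [hB]
    exact abs_integral_mul_mul_le hbd (Lp.memLp f) (Lp.memLp g)

/-- The state equation for the design `ρ` in the Hilbert space of states; `g` represents the
load. -/
def IsGraphState (A : ℝ → ℝ) (g : StateSpace Ω δ) (ρ : DesignSpace Ω δ) (x : GraphSpace Ω δ) :
    Prop :=
  x ∈ stateGraph Ω δ A ∧ ∀ y ∈ stateGraph Ω δ A,
    ∫ z, ρ z.1 * ρ z.2 * (x.snd z * y.snd z) ∂(pairD Ω δ) = ⟪g, y.fst⟫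

theorem simpCond_two (ρ : E n → ℝ) (x y : E n) : simpCond 2 ρ x y = ρ x * ρ y := by
  simp [simpCond]

theorem IsKernel.form_simpCond_two (hA : IsKernel n δ A) (ρ : E n → ℝ) {x y : GraphSpace Ω δ}
    (hx : x ∈ stateGraph Ω δ A) (hy : y ∈ stateGraph Ω δ A) :
    form Ω δ A (simpCond 2 ρ) x.fst y.fst =
      ∫ z, ρ z.1 * ρ z.2 * (x.snd z * y.snd z) ∂(pairD Ω δ) := by
  rw [hA.form_fst _ hx hy]
  simp only [simpCond_two]

theorem IsGraphState.isState (hA : IsKernel n δ A) (hΩ : Bornology.IsBounded Ω)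
    {f : E n → ℝ} {g : StateSpace Ω δ} (hg : ∀ v : StateSpace Ω δ, load Ω f v = ⟪g, v⟫)
    {ρ : DesignSpace Ω δ} {x : GraphSpace Ω δ} (hx : IsGraphState A g ρ x) :
    IsState Ω δ A f (simpCond 2 ρ) x.fst := by
  refine ⟨hA.fst_mem_energySpaceZero hΩ hx.1, fun v hv => ?_⟩
  obtain ⟨y, hy, rfl⟩ := hA.exists_of_mem_energySpaceZero hΩ hv
  rw [hA.form_simpCond_two _ hx.1 hy, hg, hx.2 y hy]

theorem IsState.exists_isGraphState (hA : IsKernel n δ A) (hΩ : Bornology.IsBounded Ω)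
    {f : E n → ℝ} {g : StateSpace Ω δ} (hg : ∀ v : StateSpace Ω δ, load Ω f v = ⟪g, v⟫)
    {ρ : DesignSpace Ω δ} {u : StateSpace Ω δ} (hu : IsState Ω δ A f (simpCond 2 ρ) u) :
    ∃ x, IsGraphState A g ρ x ∧ x.fst = u := by
  obtain ⟨x, hx, rfl⟩ := hA.exists_of_mem_energySpaceZero hΩ hu.1
  refine ⟨x, ⟨hx, fun y hy => ?_⟩, rfl⟩
  rw [← hA.form_simpCond_two _ hx hy, hu.2 _ (hA.fst_mem_energySpaceZero hΩ hy), hg]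

/-- The function component of a state, as a bounded operator. -/
noncomputable def stateFst (Ω : Set (E n)) (δ : ℝ) (A : ℝ → ℝ) :
    stateGraph Ω δ A →L[ℝ] StateSpace Ω δ :=
  (WithLp.fstL 2 ℝ (StateSpace Ω δ) (Lp ℝ 2 (pairD Ω δ))).comp (stateGraph Ω δ A).subtypeL

/-- The weighted difference component of a state, as a bounded operator. -/
noncomputable def stateSnd (Ω : Set (E n)) (δ : ℝ) (A : ℝ → ℝ) :
    stateGraph Ω δ A →L[ℝ] Lp ℝ 2 (pairD Ω δ) :=
  (WithLp.sndL 2 ℝ (StateSpace Ω δ) (Lp ℝ 2 (pairD Ω δ))).comp (stateGraph Ω δ A).subtypeL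

/-- Solvability of the state equation, by the Lax-Milgram theorem. -/
theorem IsKernel.exists_isGraphState (hA : IsKernel n δ A) (hn : 2 ≤ n) (hΩo : IsOpen Ω)
    (hΩ : Bornology.IsBounded Ω) (hδ : 0 < δ) (hρlo : 0 < ρlo) (g : StateSpace Ω δ)
    {ρ : DesignSpace Ω δ} (hρ : ρ ∈ admissible Ω δ ρlo ρhi γ) : ∃ x, IsGraphState A g ρ x := by
  obtain ⟨B, hB, hBlo, -⟩ := exists_conductivity_bilin hΩ hρlo hρ
  obtain ⟨C, hC, hP⟩ := hA.exists_norm_fst_le hn hΩo hΩ hδ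
  let a := B.bilinearComp (stateSnd Ω δ A) (stateSnd Ω δ A)
  have hcoer : IsCoercive a := by
    refine ⟨ρlo ^ 2 / (C ^ 2 + 1), by positivity, fun x => ?_⟩
    have h1 := hBlo (stateSnd Ω δ A x)
    have h2 := hP x x.2
    have h3 : ‖x‖ ^ 2 = ‖(x : GraphSpace Ω δ).fst‖ ^ 2 + ‖(x : GraphSpace Ω δ).snd‖ ^ 2 :=
      WithLp.prod_norm_sq_eq_of_L2 _
    have h4 : ‖x‖ ^ 2 ≤ (C ^ 2 + 1) * ‖(x : GraphSpace Ω δ).snd‖ ^ 2 := by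
      have h5 : ‖(x : GraphSpace Ω δ).fst‖ ^ 2 ≤ (C * ‖(x : GraphSpace Ω δ).snd‖) ^ 2 := by
        gcongr
      rw [mul_pow] at h5
      linarith
    calc ρlo ^ 2 / (C ^ 2 + 1) * ‖x‖ * ‖x‖ = ρlo ^ 2 / (C ^ 2 + 1) * ‖x‖ ^ 2 := by ring
      _ ≤ ρlo ^ 2 / (C ^ 2 + 1) * ((C ^ 2 + 1) * ‖(x : GraphSpace Ω δ).snd‖ ^ 2) := by gcongr
      _ = ρlo ^ 2 * ‖(x : GraphSpace Ω δ).snd‖ ^ 2 := by field_simp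
      _ ≤ a x x := h1
  let g' : stateGraph Ω δ A := (stateFst Ω δ A).adjoint g
  refine ⟨(hcoer.continuousLinearEquivOfBilin.symm g' : stateGraph Ω δ A), Subtype.coe_prop _,
    fun y hy => ?_⟩
  have h1 := hcoer.continuousLinearEquivOfBilin_apply
    (hcoer.continuousLinearEquivOfBilin.symm g') ⟨y, hy⟩
  rw [ContinuousLinearEquiv.apply_symm_apply, ContinuousLinearMap.adjoint_inner_left] at h1
  rw [← hB]
  exact h1.symm

theorem IsGraphState.norm_snd_le (hΩ : Bornology.IsBounded Ω) (hρlo : 0 < ρlo)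
    {g : StateSpace Ω δ} {ρ : DesignSpace Ω δ} (hρ : ρ ∈ admissible Ω δ ρlo ρhi γ) {C : ℝ}
    (hC : 0 < C) (hP : ∀ x ∈ stateGraph Ω δ A, ‖x.fst‖ ≤ C * ‖x.snd‖) {x : GraphSpace Ω δ}
    (hx : IsGraphState A g ρ x) : ‖x.snd‖ ≤ ‖g‖ * C / ρlo ^ 2 := by
  obtain ⟨B, hB, hBlo, -⟩ := exists_conductivity_bilin hΩ hρlo hρ
  have h1 := hBlo x.snd
  rw [hB, hx.2 x hx.1] at h1
  have h2 := real_inner_le_norm g x.fst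
  have h3 := mul_le_mul_of_nonneg_left (hP x hx.1) (norm_nonneg g)
  rw [le_div_iff₀ (by positivity)]
  rcases eq_or_ne ‖x.snd‖ 0 with h0 | h0
  · rw [h0, zero_mul]
    positivity
  · have h4 : 0 < ‖x.snd‖ := lt_of_le_of_ne (norm_nonneg _) h0.symm
    refine le_of_mul_le_mul_right ?_ h4
    linarith

/-! ### Convergence of states and existence of an optimal design -/

theorem secondCountableTopology_L2 {X : Type*} [MeasurableSpace X]
    [MeasurableSpace.CountablyGenerated X] (μ : Measure X) [SFinite μ] :
    SecondCountableTopology (Lp ℝ 2 μ) := by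
  have : Fact ((2 : ℝ≥0∞) ≠ ⊤) := ⟨by simp⟩
  infer_instance

/-- A sequence of graph elements with bounded energies has a subsequence that converges weakly to a
graph element; by compactness its function components converge strongly. -/
theorem IsKernel.exists_subseq_of_norm_snd_le (hA : IsKernel n δ A) (hn : 2 ≤ n) (hΩo : IsOpen Ω)
    (hΩ : Bornology.IsBounded Ω) (hδ : 0 < δ) {w : ℕ → GraphSpace Ω δ} {K : ℝ}
    (hw : ∀ k, w k ∈ stateGraph Ω δ A) (hK : ∀ k, ‖(w k).snd‖ ≤ K) :
    ∃ w' ∈ stateGraph Ω δ A, ∃ φ : ℕ → ℕ, StrictMono φ ∧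
      Tendsto (fun k => ‖(w (φ k) - w').fst‖) atTop (𝓝 0) := by
  have := isFiniteMeasure_volD (δ := δ) hΩ
  have : SecondCountableTopology (StateSpace Ω δ) := secondCountableTopology_L2 _
  have : SecondCountableTopology (Lp ℝ 2 (pairD Ω δ)) := secondCountableTopology_L2 _
  have : SecondCountableTopology (GraphSpace Ω δ) :=
    WithLp.secondCountableTopology 2 (StateSpace Ω δ) (Lp ℝ 2 (pairD Ω δ))
  have : SecondCountableTopology (stateGraph Ω δ A) :=
    TopologicalSpace.Subtype.secondCountableTopology _
  obtain ⟨C, hC, hP⟩ := hA.exists_norm_fst_le hn hΩo hΩ hδ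
  have hbd : ∀ k, ‖(⟨w k, hw k⟩ : stateGraph Ω δ A)‖ ≤ √((C * K) ^ 2 + K ^ 2) := by
    intro k
    have h1 : ‖(⟨w k, hw k⟩ : stateGraph Ω δ A)‖ ^ 2 = ‖(w k).fst‖ ^ 2 + ‖(w k).snd‖ ^ 2 :=
      WithLp.prod_norm_sq_eq_of_L2 _
    refine Real.le_sqrt_of_sq_le ?_
    rw [h1]
    have h2 : ‖(w k).fst‖ ≤ C * K := (hP _ (hw k)).trans (by gcongr; exact hK k)
    gcongr
    exact hK k
  obtain ⟨w', φ, hφ, hlim⟩ := exists_weakly_convergent_subseq hbd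
  refine ⟨w', w'.2, φ, hφ, ?_⟩
  have hmem : ∀ k, w (φ k) - w' ∈ stateGraph Ω δ A := fun k =>
    Submodule.sub_mem _ (hw _) w'.2
  have hsnd : ∀ k, ‖(w (φ k) - w').snd‖ ≤ K + ‖(w' : GraphSpace Ω δ).snd‖ := fun k => by
    rw [WithLp.sub_snd]
    exact (norm_sub_le _ _).trans (by gcongr; exact hK _)
  refine hA.tendsto_norm_of_weak hn hΩ hδ (M := (K + ‖(w' : GraphSpace Ω δ).snd‖) ^ 2)
    (K := C * (K + ‖(w' : GraphSpace Ω δ).snd‖)) (fun k => fst_eq_zero_of_notMem (hmem k))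
    (fun k => memLp_diffQuot_fst (hmem k)) (fun k => ?_) (fun k => ?_) fun v => ?_
  · rw [integral_diffQuot_sq_fst (hmem k)]
    gcongr
    exact hsnd k
  · exact (hP _ (hmem k)).trans (by gcongr; exact hsnd k)
  · have h1 := tendsto_sub_nhds_zero_iff.2 (hlim ((stateFst Ω δ A).adjoint v))
    refine h1.congr fun k => ?_
    rw [ContinuousLinearMap.adjoint_inner_right, ContinuousLinearMap.adjoint_inner_right,
      ← inner_sub_left]
    rfl

/-- Continuity of the design-to-state map, from the weak* topology to the energy norm, along
subsequences. With `w_k = u_k - u` and `w` a weak limit of `w_k`, coercivity and the two state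
equations give `ρlo ^ 2 ‖w_k‖ ^ 2 ≤ ℓ(w_k) - a_k(u, w) - a_k(u, w_k - w)`, and the right-hand side
tends to `ℓ(w) - a(u, w) - 0 = 0`. -/
theorem IsKernel.exists_subseq_tendsto_state (hA : IsKernel n δ A) (hn : 2 ≤ n) (hΩo : IsOpen Ω)
    (hΩ : Bornology.IsBounded Ω) (hδ : 0 < δ) (hρlo : 0 < ρlo) {g : StateSpace Ω δ}
    {ρ : ℕ → DesignSpace Ω δ} {ρ' : DesignSpace Ω δ}
    (hρ : ∀ k, ρ k ∈ admissible Ω δ ρlo ρhi γ) (hρ' : ρ' ∈ admissible Ω δ ρlo ρhi γ)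
    (hlim : WeakStarTendsto ρ ρ') {x : ℕ → GraphSpace Ω δ} {y : GraphSpace Ω δ}
    (hx : ∀ k, IsGraphState A g (ρ k) (x k)) (hy : IsGraphState A g ρ' y) :
    ∃ φ : ℕ → ℕ, StrictMono φ ∧ Tendsto (fun k => ‖(x (φ k) - y).snd‖) atTop (𝓝 0) := by
  obtain ⟨C, hC, hP⟩ := hA.exists_norm_fst_le hn hΩo hΩ hδ
  set K := ‖g‖ * C / ρlo ^ 2
  have hw : ∀ k, x k - y ∈ stateGraph Ω δ A := fun k => Submodule.sub_mem _ (hx k).1 hy.1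
  have hK : ∀ k, ‖(x k - y).snd‖ ≤ K + K := fun k => by
    rw [WithLp.sub_snd]
    exact (norm_sub_le _ _).trans (add_le_add ((hx k).norm_snd_le hΩ hρlo (hρ k) hC hP)
      (hy.norm_snd_le hΩ hρlo hρ' hC hP))
  obtain ⟨w', hw', φ, hφ, hfst⟩ := hA.exists_subseq_of_norm_snd_le hn hΩo hΩ hδ hw hK
  refine ⟨φ, hφ, ?_⟩
  have hv : ∀ k, x (φ k) - y - w' ∈ stateGraph Ω δ A := fun k => Submodule.sub_mem _ (hw _) hw'
  choose B hB hBlo hBhi using fun k => exists_conductivity_bilin hΩ hρlo (hρ (φ k))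
  have hload : Tendsto (fun k => ⟪g, (x (φ k) - y).fst⟫) atTop (𝓝 ⟪g, w'.fst⟫) := by
    have h1 : Tendsto (fun k => (x (φ k) - y).fst) atTop (𝓝 w'.fst) := by
      rw [tendsto_iff_norm_sub_tendsto_zero]
      exact hfst
    exact tendsto_const_nhds.inner h1
  have hlimφ : WeakStarTendsto (fun k => ρ (φ k)) ρ' := fun ψ hψ =>
    (hlim ψ hψ).comp hφ.tendsto_atTop
  have hfixed : Tendsto (fun k => B k y.snd w'.snd) atTop (𝓝 ⟪g, w'.fst⟫) := by
    rw [← hy.2 w' hw']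
    simp only [hB]
    exact tendsto_integral_mul_conductivity hΩ hρlo (fun k => hρ (φ k)) hρ' hlimφ
      ((Lp.memLp y.snd).integrable_mul (Lp.memLp w'.snd))
  have hvanish : Tendsto (fun k => B k y.snd (x (φ k) - y - w').snd) atTop (𝓝 0) := by
    have h1 := (hA.tendsto_integral_abs_mul_abs_diffQuot hΩ (Lp.memLp y.snd)
      (e := fun k => (x (φ k) - y - w').fst) (M := (K + K + ‖w'.snd‖) ^ 2)
      (fun k => memLp_diffQuot_fst (hv k)) (fun k => ?_) hfst).const_mul (ρhi ^ 2)
    · rw [mul_zero] at h1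
      refine squeeze_zero_norm (fun k => ?_) h1
      refine (hBhi k _ _).trans (le_of_eq ?_)
      congr 1
      refine integral_congr_ae ?_
      filter_upwards [snd_eq_diffQuot (hv k)] with z hz
      rw [hz]
    · rw [integral_diffQuot_sq_fst (hv k), WithLp.sub_snd _ w']
      gcongr
      exact (norm_sub_le _ _).trans (by gcongr; exact hK _)
  have hest : ∀ k, ρlo ^ 2 * ‖(x (φ k) - y).snd‖ ^ 2 ≤ ⟪g, (x (φ k) - y).fst⟫ -
      B k y.snd w'.snd - B k y.snd (x (φ k) - y - w').snd := by
    intro k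
    refine (hBlo k _).trans (le_of_eq ?_)
    have h1 : B k (x (φ k)).snd (x (φ k) - y).snd = ⟪g, (x (φ k) - y).fst⟫ := by
      rw [hB, (hx (φ k)).2 _ (hw _)]
    rw [← h1, WithLp.sub_snd _ w', WithLp.sub_snd _ y]
    simp only [map_sub, sub_apply]
    ring
  have hsq : Tendsto (fun k => ρlo ^ 2 * ‖(x (φ k) - y).snd‖ ^ 2) atTop (𝓝 0) := by
    refine squeeze_zero (fun k => by positivity) hest ?_
    simpa using (hload.sub hfixed).sub hvanish
  have h2 := (hsq.const_mul (ρlo ^ 2)⁻¹).sqrt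
  simp only [inv_mul_cancel_left₀ (show ρlo ^ 2 ≠ 0 by positivity), Real.sqrt_sq (norm_nonneg _),
    mul_zero, Real.sqrt_zero] at h2
  exact h2

/-- The constant design `ρlo` is admissible. -/
theorem exists_mem_admissible (hΩ : Bornology.IsBounded Ω) (hδ : 0 < δ)
    (hρ : ρlo < ρhi) (hγ : ρlo < γ) : ∃ ρ, ρ ∈ admissible Ω δ ρlo ρhi γ := by
  have := isFiniteMeasure_volD (δ := δ) hΩ
  have hm : MemLp (fun _ => ρlo) ∞ (volD Ω δ) := memLp_const ρlo
  refine ⟨hm.toLp _, ?_, ?_⟩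
  · filter_upwards [hm.coeFn_toLp] with x hx
    rw [hx]
    exact ⟨le_rfl, hρ.le⟩
  · have h1 : ∀ᵐ x ∂(volume.restrict Ω), hm.toLp _ x = ρlo :=
      ae_mono (Measure.restrict_mono (Metric.self_subset_thickening hδ Ω) le_rfl) hm.coeFn_toLp
    rw [integral_congr_ae h1, setIntegral_const, smul_eq_mul, mul_comm]
    gcongr

/-- Every sequence of feasible pairs has a subsequence that converges to a feasible pair, weakly*
in the designs and in energy norm in the states. -/
theorem IsKernel.exists_subseq_feasible (hA : IsKernel n δ A) (hn : 2 ≤ n) (hΩo : IsOpen Ω)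
    (hΩ : Bornology.IsBounded Ω) (hδ : 0 < δ) (hρlo : 0 < ρlo)
    (f : Lp ℝ 2 (volume.restrict Ω)) {q : ℕ → DesignSpace Ω δ × StateSpace Ω δ}
    (hq : ∀ k, q k ∈ feasible Ω δ A f ρlo ρhi γ 2) :
    ∃ q' ∈ feasible Ω δ A f ρlo ρhi γ 2, ∃ φ : ℕ → ℕ, StrictMono φ ∧
      WeakStarTendsto (fun k => (q (φ k)).1) q'.1 ∧
      Tendsto (fun k => stateNorm Ω δ A ((q (φ k)).2 - q'.2)) atTop (𝓝 0) := by
  obtain ⟨g, hg⟩ := exists_load_eq_inner hΩo hδ f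
  obtain ⟨ρ', hρ', φ, hφ, hlim⟩ := exists_weakStar_subseq hΩo hΩ hδ hρlo fun k => (hq k).1
  obtain ⟨y, hy⟩ := hA.exists_isGraphState hn hΩo hΩ hδ hρlo g hρ'
  choose x hx hxq using fun k => (hq (φ k)).2.exists_isGraphState hA hΩ hg
  obtain ⟨θ, hθ, hstate⟩ := hA.exists_subseq_tendsto_state hn hΩo hΩ hδ hρlo
    (fun k => (hq (φ k)).1) hρ' hlim hx hy
  refine ⟨(ρ', y.fst), ⟨hρ', hy.isState hA hΩ hg⟩, φ ∘ θ, hφ.comp hθ,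
    fun ψ hψ => (hlim ψ hψ).comp hθ.tendsto_atTop, hstate.congr fun k => ?_⟩
  rw [← hA.stateNorm_fst (Submodule.sub_mem _ (hx (θ k)).1 hy.1), WithLp.sub_fst, hxq]
  rfl

end NonlocalDesign

theorem mainTheorem5 (n : ℕ) (hn : 2 ≤ n)
    (Ω : Set (E n)) (hΩ_open : IsOpen Ω) (hΩ_bdd : Bornology.IsBounded Ω)
    (hΩ_conn : IsConnected Ω)
    (δ : ℝ) (hδ : 0 < δ)
    (A : ℝ → ℝ) (hA : IsKernel n δ A)
    (f : Lp ℝ 2 (volume.restrict Ω))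
    (ρlo ρhi γ : ℝ) (hρlo : 0 < ρlo) (hρ : ρlo < ρhi) (hγ : γ ∈ Set.Ioo ρlo ρhi)
    (J : DesignSpace Ω δ → StateSpace Ω δ → ℝ)
    (hJ : SeqLowerSemicontinuousObjective Ω δ A ρlo ρhi γ J) :
    ∃ (ρopt : DesignSpace Ω δ) (uopt : StateSpace Ω δ),
      (ρopt, uopt) ∈ feasible Ω δ A f ρlo ρhi γ 2 ∧
      ∀ (ρ : DesignSpace Ω δ) (u : StateSpace Ω δ),
        (ρ, u) ∈ feasible Ω δ A f ρlo ρhi γ 2 → J ρopt uopt ≤ J ρ u := by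
  have hne : (feasible Ω δ A f ρlo ρhi γ 2).Nonempty := by
    obtain ⟨g, hg⟩ := exists_load_eq_inner hΩ_open hδ f
    obtain ⟨ρ, hadm⟩ := exists_mem_admissible hΩ_bdd hδ hρ hγ.1
    obtain ⟨x, hx⟩ := hA.exists_isGraphState hn hΩ_open hΩ_bdd hδ hρlo g hadm
    exact ⟨(ρ, x.fst), hadm, hx.isState hA hΩ_bdd hg⟩
  -- the infimum is taken in `EReal`, where it exists although `J` need not be bounded below
  set S : Set EReal := (fun q : DesignSpace Ω δ × StateSpace Ω δ => (J q.1 q.2 : EReal)) ''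
    feasible Ω δ A f ρlo ρhi γ 2 with hS
  obtain ⟨a, -, ha, haS⟩ :=
    exists_seq_tendsto_sInf (hne.image _ : S.Nonempty) (OrderBot.bddBelow S)
  choose q hq hqa using haS
  obtain ⟨q', hq', φ, hφ, hweak, hnorm⟩ :=
    hA.exists_subseq_feasible hn hΩ_open hΩ_bdd hδ hρlo f hq
  refine ⟨q'.1, q'.2, hq', fun ρ u hρu => ?_⟩
  have hlsc := hJ (fun k => (q (φ k)).1) q'.1 (fun k => (q (φ k)).2) q'.2 (fun k => (hq _).1) hq'.1
    (fun k => (hq _).2.1) hq'.2.1 hweak hnorm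
  have hvalues : Tendsto (fun k => (J (q (φ k)).1 (q (φ k)).2 : EReal)) atTop (𝓝 (sInf S)) :=
    (ha.comp hφ.tendsto_atTop).congr fun k => (hqa (φ k)).symm
  rw [hvalues.liminf_eq] at hlsc
  exact EReal.coe_le_coe_iff.1 (hlsc.trans (sInf_le ⟨(ρ, u), hρu, rfl⟩))
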